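/- Let $p$ be a prime, $k$ a field of characteristic $p$, and $G$ a finite group scheme over $k$ (an affine group scheme with finite dimensional coordinate algebra $k[G]$), with group algebra $kG=\operatorname{Hom}_k(k[G],k)$, a Hopf algebra with antipode $S$. For a field extension $K/k$ write $KG=K\otimes_k kG=KG_K$ for the group algebra of the base change $G_K$, and $M_K=K\otimes_k M$ for a $kG$-module $M$. The dual $M^\#=\operatorname{Hom}_k(M,k)$ of a finite dimensional $kG$-module $M$ is a $kG$-module by $(xf)(m)=f(S(x)m)$; duals of $KG$-modules are defined likewise, and duals of $K[t]/t^p$-modules are formed with the antipode $t\mapsto -t$ (that is, $t$ is primitive). A $\pi$-point of $G$ is a left flat map of $K$-algebras $\alpha_K\colon K[t]/t^p\to KG$, for some field extension $K/k$, which factors through the group algebra $KC_K\subset KG_K$ of some unipotent abelian subgroup scheme $C_K\subset G_K$. For a $KG$-module $N$, $\alpha_K^*(N)$ denotes its restriction along $\alpha_K$. The Jordan type $a_p[p]+\cdots+a_1[1]$ of a finite dimensional $K[t]/t^p$-module records the number $a_i$ of Jordan blocks of size $i$ of the action of $t$. For Jordan types $\underline a,\underline b$ with $\sum_i i a_i=\sum_i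 i b_i$, write $\underline a\ge\underline b$ for the dominance order on partitions, that is, $$\sum_{i=j}^{p}(i-j+1)\,a_i\ \ge\ \sum_{i=j}^{p}(i-j+1)\,b_i\qquad (1\le j\le p),$$ and $\underline a>\underline b$ if moreover one of these inequalities is strict. The $\pi$-point $\alpha_K$ has maximal Jordan type on $M$ if there is no $\pi$-point $\beta_L\colon L[t]/t^p\to LG$ (with $L/k$ any field extension) such that the Jordan type of $\beta_L^*(M_L)$ is strictly greater than that of $\alpha_K^*(M_K)$. **Proposition 5.2.** Let $M$ be a finite dimensional $kG$-module and let $\alpha_K\colon K[t]/t^p\to KG$ be a $\pi$-point of $G$. If $\alpha_K$ has maximal Jordan type on $M$, then there are isomorphisms of $K[t]/t^p$-modules $$\alpha_K^*(M_K^\#)\ \simeq\ \alpha_K^*(M_K)\ \simeq\ (\alpha_K^*(M_K))^\#.$$ Moreover, $\alpha_K$ has maximal Jordan type on $M$ if and only if it has maximal Jordan type on $M^\#$. -/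

import Mathlib

open scoped TensorProduct

noncomputable section

namespace FiniteGroupScheme

universe u v w

/-! A finite group scheme `G` over a field `k` is given by its coordinate algebra `A = k[G]`, a
finite dimensional commutative Hopf algebra over `k`. -/

section GroupAlgebra

variable (k : Type*) [Field k] (A : Type*) [CommRing A] [HopfAlgebra k A]

/-- The group algebra `kG` of `G`: the linear dual of `k[G]`, with the product dual to the
comultiplication of `k[G]` (the convolution product); its unit is the counit of `k[G]`. -/
abbrev GroupAlg : Type _ := WithConv (A →ₗ[k] k)

/-- The augmentation `kG → k`, evaluation of a functional at `1 ∈ k[G]`. -/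
def augmentation : GroupAlg k A →ₗ[k] k :=
  LinearMap.applyₗ (1 : A) ∘ₗ (WithConv.linearEquiv k (A →ₗ[k] k)).toLinearMap

variable {k A}

/-- A coalgebra map `k[G] → k[H]` induces the algebra map `kH → kG` dual to it. -/
def GroupAlg.map {B : Type*} [CommRing B] [HopfAlgebra k B] (q : A →ₐc[k] B) :
    GroupAlg k B →ₐ[k] GroupAlg k A :=
  AlgHom.ofLinearMap
    { toFun := fun f => WithConv.toConv (f.ofConv ∘ₗ (q : A →ₗc[k] B).toLinearMap)
      map_add' := fun f g => by ext; simp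
      map_smul' := fun c f => by ext; simp }
    (by
      apply WithConv.ofConv_injective
      ext a
      simp [LinearMap.convOne_def])
    (by
      intro f g
      apply WithConv.ofConv_injective
      exact LinearMap.convMul_comp_coalgHom_distrib f g (q : A →ₗc[k] B))

/-- The antipode of `k[G]` reverses the comultiplication. -/
theorem comul_antipode (a : A) :
    Coalgebra.comul (R := k) (HopfAlgebra.antipode k a) =
      TensorProduct.map (HopfAlgebra.antipode k) (HopfAlgebra.antipode k)
        (TensorProduct.comm k A A (Coalgebra.comul a)) := by
  let i₁ : WithConv (A →ₐ[k] A ⊗[k] A) := WithConv.toConv Algebra.TensorProduct.includeLeft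
  let i₂ : WithConv (A →ₐ[k] A ⊗[k] A) := WithConv.toConv Algebra.TensorProduct.includeRight
  have h : i₁ * i₂ = WithConv.toConv (Bialgebra.comulAlgHom k A) := by
    apply WithConv.ofConv_injective
    ext a
    change (i₁ * i₂) a = _
    rw [AlgHom.convMul_apply]
    simp only [i₁, i₂, Algebra.TensorProduct.lift_includeLeft_includeRight]
    simp
  have h2 := mul_inv_rev i₁ i₂
  rw [h] at h2
  have h3 : (i₂⁻¹ * i₁⁻¹) a = TensorProduct.map (HopfAlgebra.antipode k) (HopfAlgebra.antipode k)
        (TensorProduct.comm k A A (Coalgebra.comul a)) := by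
    rw [AlgHom.convMul_apply]
    induction (Coalgebra.comul (R := k) a) using TensorProduct.induction_on with
    | zero => simp
    | add x y hx hy => simp only [map_add, hx, hy]
    | tmul x y =>
      simp [i₁, i₂, Inv.inv]
  rw [← h3, ← h2]
  rfl

variable (k A)

/-- The antipode `S` of `kG`, the transpose of the antipode of `k[G]`. It is an
anti-homomorphism of algebras, that is, an algebra map to the opposite algebra. -/
def GroupAlg.antipode : GroupAlg k A →ₐ[k] (GroupAlg k A)ᵐᵒᵖ :=
  AlgHom.ofLinearMap
    { toFun := fun f => MulOpposite.op (WithConv.toConv (f.ofConv ∘ₗ HopfAlgebra.antipode k))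
      map_add' := fun f g => by
        apply MulOpposite.unop_injective; ext; simp
      map_smul' := fun c f => by
        apply MulOpposite.unop_injective; ext; simp }
    (by
      apply MulOpposite.unop_injective
      apply WithConv.ofConv_injective
      ext a
      simp [LinearMap.convOne_def])
    (by
      intro f g
      apply MulOpposite.unop_injective
      apply WithConv.ofConv_injective
      ext a
      simp only [LinearMap.convMul_def, LinearMap.coe_mk, AddHom.coe_mk, MulOpposite.unop_op,
        MulOpposite.unop_mul, LinearMap.comp_apply, comul_antipode]
      induction (Coalgebra.comul (R := k) a) using TensorProduct.induction_on with
      | zero => simp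
      | add x y hx hy => simp only [map_add, hx, hy]
      | tmul x y => simp [mul_comm])

end GroupAlgebra

section BaseChange

variable (k : Type*) [Field k] (A : Type*) [CommRing A] [HopfAlgebra k A]
  (K : Type*) [Field K] [Algebra k K]

/-- The inclusion `kG → KG_K` for a field extension `K/k`, where `K[G_K] = K ⊗ k[G]`. -/
def GroupAlg.toBaseChange : GroupAlg k A →ₐ[k] GroupAlg K (K ⊗[k] A) :=
  AlgHom.ofLinearMap
    { toFun := fun f => WithConv.toConv (Module.Dual.baseChange K f.ofConv)
      map_add' := fun f g => by apply WithConv.ofConv_injective; simp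
      map_smul' := fun c f => by apply WithConv.ofConv_injective; simp }
    (by
      apply WithConv.ofConv_injective
      ext a
      simp [LinearMap.convOne_def, Algebra.smul_def])
    (by
      intro f g
      apply WithConv.ofConv_injective
      ext a
      simp [LinearMap.convMul_def, TensorProduct.comul_tmul]
      induction (Coalgebra.comul (R := k) a) using TensorProduct.induction_on with
      | zero => simp
      | add x y hx hy => simp only [map_add, add_smul, TensorProduct.tmul_add, hx, hy]
      | tmul x y => simp [Algebra.smul_def])

instance : IsScalarTower k K (GroupAlg K (K ⊗[k] A)) where
  smul_assoc c d f := by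
    apply WithConv.ofConv_injective
    ext a
    simp

/-- The canonical map `K ⊗ kG → KG_K`. -/
def GroupAlg.baseChangeHom : K ⊗[k] GroupAlg k A →ₐ[K] GroupAlg K (K ⊗[k] A) :=
  Algebra.TensorProduct.lift (Algebra.ofId K _) (GroupAlg.toBaseChange k A K)
    (fun c _ => by
      rw [Algebra.ofId_apply]
      exact Algebra.commute_algebraMap_left c _)

theorem GroupAlg.baseChangeHom_bijective [Module.Finite k A] :
    Function.Bijective (GroupAlg.baseChangeHom k A K) := by
  have : Module.FinitePresentation k A := Module.finitePresentation_of_finite k A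
  have hb := Module.FinitePresentation.isBaseChange_map k A k K
  let e : K ⊗[k] GroupAlg k A ≃ₗ[K] GroupAlg K (K ⊗[k] A) :=
    ((WithConv.linearEquiv k (A →ₗ[k] k)).baseChange k K _ _) ≪≫ₗ hb.equiv ≪≫ₗ
      (TensorProduct.AlgebraTensorModule.rid k K K).congrRight ≪≫ₗ
      (WithConv.linearEquiv K (K ⊗[k] A →ₗ[K] K)).symm
  have he : ∀ x, GroupAlg.baseChangeHom k A K x = e x := by
    intro x
    induction x using TensorProduct.induction_on with
    | zero => simp
    | add x y hx hy => simp only [map_add, hx, hy]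
    | tmul c f =>
      apply WithConv.ofConv_injective
      ext a
      simp [GroupAlg.baseChangeHom, GroupAlg.toBaseChange, e, IsBaseChange.equiv_tmul,
        Algebra.ofId_apply, ← Algebra.smul_def]
      change f.ofConv a • c = c * (f.ofConv a • (1 : K))
      simp [mul_comm, Algebra.smul_def]
  have : (GroupAlg.baseChangeHom k A K : K ⊗[k] GroupAlg k A → GroupAlg K (K ⊗[k] A)) = e :=
    funext he
  rw [this]
  exact e.bijective

/-- The canonical identification `K ⊗ kG = KG_K`. -/
def GroupAlg.baseChangeEquiv [Module.Finite k A] :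
    K ⊗[k] GroupAlg k A ≃ₐ[K] GroupAlg K (K ⊗[k] A) :=
  AlgEquiv.ofBijective _ (GroupAlg.baseChangeHom_bijective k A K)

end BaseChange

section Representations

/-! A module over a `k`-algebra `H` is given by a vector space `V` and an algebra map
`ρ : H → End_k(V)`. -/

variable {k : Type*} [Field k] {H : Type*} [Ring H] [Algebra k H]
  {V : Type*} [AddCommGroup V] [Module k V] {W : Type*} [AddCommGroup W] [Module k W]

/-- Isomorphism of `H`-modules. -/
def RepIso (ρ : H →ₐ[k] Module.End k V) (σ : H →ₐ[k] Module.End k W) : Prop :=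
  ∃ e : V ≃ₗ[k] W, ∀ (x : H) (v : V), e (ρ x v) = σ x (e v)

/-- The dual module with respect to an anti-homomorphism `S` of `H`:
`(x • f)(v) = f(S(x) • v)` on the linear dual of `V`. -/
def dualVia (S : H →ₐ[k] Hᵐᵒᵖ) (ρ : H →ₐ[k] Module.End k V) :
    H →ₐ[k] Module.End k (Module.Dual k V) :=
  AlgHom.ofLinearMap
    { toFun := fun x => Module.Dual.transpose (ρ (S x).unop)
      map_add' := fun x y => by simp
      map_smul' := fun c x => by simp }
    (by ext; simp [Module.Dual.transpose])
    (fun x y => by ext; simp [Module.Dual.transpose])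

end Representations

section GRepresentations

variable {k : Type*} [Field k] {A : Type*} [CommRing A] [HopfAlgebra k A]
  {V : Type*} [AddCommGroup V] [Module k V]

/-- The dual `M^#` of a `kG`-module `M`. -/
def dual (ρ : GroupAlg k A →ₐ[k] Module.End k V) :
    GroupAlg k A →ₐ[k] Module.End k (Module.Dual k V) :=
  dualVia (GroupAlg.antipode k A) ρ

/-- The `KG_K`-module `M_K = K ⊗ M`, on which `c ⊗ x ∈ K ⊗ kG = KG_K` acts by
`d ⊗ m ↦ c d ⊗ x m`. -/
def baseChange [Module.Finite k A] (K : Type*) [Field K] [Algebra k K]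
    (ρ : GroupAlg k A →ₐ[k] Module.End k V) :
    GroupAlg K (K ⊗[k] A) →ₐ[K] Module.End K (K ⊗[k] V) :=
  (Algebra.TensorProduct.lift (Algebra.ofId K (Module.End K (K ⊗[k] V)))
    ((Module.End.baseChangeHom k K V).comp ρ) (fun c _ => by
      rw [Algebra.ofId_apply]
      exact Algebra.commute_algebraMap_left c _)).comp
      (GroupAlg.baseChangeEquiv k A K).symm.toAlgHom

end GRepresentations

section TruncatedPolynomials

variable (K : Type*) [Field K] (p : ℕ)

/-- The algebra `K[t]/t^p`. -/
abbrev TruncPoly : Type _ := Polynomial K ⧸ Ideal.span {(Polynomial.X : Polynomial K) ^ p}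

/-- The class of `t` in `K[t]/t^p`. -/
def TruncPoly.t : TruncPoly K p := Ideal.Quotient.mk _ Polynomial.X

/-- The antipode of `K[t]/t^p` for the Hopf algebra structure in which `t` is primitive: the
algebra map with `t ↦ -t`, regarded as an anti-homomorphism. -/
def TruncPoly.antipode : TruncPoly K p →ₐ[K] (TruncPoly K p)ᵐᵒᵖ :=
  (AlgEquiv.toOpposite K (TruncPoly K p)).toAlgHom.comp
    (Ideal.Quotient.liftₐ _ (Polynomial.aeval (Ideal.Quotient.mk _ (-Polynomial.X))) (by
      intro a ha
      obtain ⟨b, rfl⟩ := Ideal.mem_span_singleton'.1 ha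
      rw [map_mul, map_pow, Polynomial.aeval_X, ← map_pow]
      have h : (Ideal.Quotient.mk (Ideal.span {(Polynomial.X : Polynomial K) ^ p}))
          ((-Polynomial.X) ^ p) = 0 := by
        rw [Ideal.Quotient.eq_zero_iff_mem, neg_pow]
        exact Ideal.mul_mem_left _ _ (Ideal.mem_span_singleton_self _)
      rw [h, mul_zero]))

variable {K p}

/-- A Jordan type `a_p[p] + ⋯ + a_1[1]`; the value `a i` is the number `a_{i+1}` of blocks of
size `i + 1`, for `i = 0, …, p - 1`. -/
abbrev JordanType (p : ℕ) : Type := Fin p → ℕ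

/-- A `K[t]/t^p`-module has Jordan type `a` if it has a basis in which `t` acts by a direct sum of
nilpotent Jordan blocks, `a i` of them of size `i + 1`: here `b ⟨i, c, l⟩` is the `l`-th basis
vector of the `c`-th block of size `i + 1`. -/
def HasJordanType {W : Type*} [AddCommGroup W] [Module K W]
    (σ : TruncPoly K p →ₐ[K] Module.End K W) (a : JordanType p) : Prop :=
  ∃ b : Module.Basis (Σ i : Fin p, Fin (a i) × Fin (i.val + 1)) K W,
    ∀ (i : Fin p) (c : Fin (a i)) (l : Fin (i.val + 1)),
      σ (TruncPoly.t K p) (b ⟨i, c, l⟩) =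
        if h : l.val + 1 < i.val + 1 then b ⟨i, c, ⟨l.val + 1, h⟩⟩ else 0

/-- The number of boxes outside the first `j` columns of the Young diagram whose rows are the
blocks of `a`. It is `∑ (s - j) a_s` over the block sizes `s > j` (the subtraction is truncated, so
smaller blocks contribute `0`). -/
def JordanType.tail (a : JordanType p) (j : ℕ) : ℕ := ∑ i : Fin p, (i.val + 1 - j) * a i

/-- The dominance order on Jordan types of modules of the same dimension, `a ≥ b`, expressed by
columns. -/
def JordanType.Dominates (a b : JordanType p) : Prop :=
  a.tail 0 = b.tail 0 ∧ ∀ j : ℕ, b.tail j ≤ a.tail j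

/-- The strict dominance order `a > b`. -/
def JordanType.StrictlyDominates (a b : JordanType p) : Prop :=
  a.Dominates b ∧ ∃ j : ℕ, b.tail j < a.tail j

end TruncatedPolynomials

section PiPoints

/-- A finite group scheme `C` over `K`, with coordinate algebra `B`, is unipotent if every nonzero
finite dimensional representation of `C` has a nonzero fixed vector. -/
def IsUnipotent (K : Type*) [Field K] (B : Type*) [CommRing B] [HopfAlgebra K B] : Prop :=
  ∀ (n : ℕ) (τ : GroupAlg K B →ₐ[K] Module.End K (Fin (n + 1) → K)),
    ∃ v : Fin (n + 1) → K, v ≠ 0 ∧ ∀ x : GroupAlg K B, τ x v = augmentation K B x • v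

/-- An algebra map `f : R → H` from a commutative ring is left flat if `H` is flat as a left
`R`-module via `r • h = f(r) h`. -/
def IsLeftFlat {R H : Type*} [CommRing R] [Ring H] (f : R →+* H) : Prop :=
  letI : Module R H := Module.compHom H f
  Module.Flat R H

/-- `α : K[t]/t^p → KG_K` is a `π`-point of `G`: it is left flat and factors through the group
algebra `KC → KG_K` of some unipotent abelian closed subgroup scheme `C ⊆ G_K`. The closed subgroup
schemes of `G_K` are given by the Hopf ideals `I` of `K[G_K] = K ⊗ k[G]`, with
`K[C] = K[G_K] ⧸ I`, and `C` is abelian when `K[C]` is cocommutative. -/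
def IsPiPoint {k : Type*} [Field k] {A : Type*} [CommRing A] [HopfAlgebra k A]
    {K : Type*} [Field K] [Algebra k K] {p : ℕ}
    (α : TruncPoly K p →ₐ[K] GroupAlg K (K ⊗[k] A)) : Prop :=
  IsLeftFlat α.toRingHom ∧
    ∃ (I : Ideal (K ⊗[k] A)) (_ : I.IsHopfIdeal K),
      Coalgebra.IsCocomm K ((K ⊗[k] A) ⧸ I) ∧ IsUnipotent K ((K ⊗[k] A) ⧸ I) ∧
        ∃ β : TruncPoly K p →ₐ[K] GroupAlg K ((K ⊗[k] A) ⧸ I),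
          α = (GroupAlg.map (Bialgebra.Quotient.mkBialgHom (R := K) I)).comp β

/-- The `K[t]/t^p`-module `α^*(M_K)`. -/
abbrev restrict {k : Type*} [Field k] {A : Type*} [CommRing A] [HopfAlgebra k A]
    [Module.Finite k A] {V : Type*} [AddCommGroup V] [Module k V]
    {K : Type*} [Field K] [Algebra k K] {p : ℕ}
    (α : TruncPoly K p →ₐ[K] GroupAlg K (K ⊗[k] A))
    (ρ : GroupAlg k A →ₐ[k] Module.End k V) : TruncPoly K p →ₐ[K] Module.End K (K ⊗[k] V) :=
  (baseChange K ρ).comp α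

/-- `α` has maximal Jordan type on the `kG`-module `M` given by `ρ`: there is no `π`-point
`β : L[t]/t^p → LG_L`, for any field extension `L/k`, such that the Jordan type of `β^*(M_L)` is
strictly greater than the Jordan type of `α^*(M_K)`. -/
def HasMaximalJordanType {k : Type u} [Field k] {A : Type v} [CommRing A] [HopfAlgebra k A]
    [Module.Finite k A] {V : Type*} [AddCommGroup V] [Module k V]
    {K : Type w} [Field K] [Algebra k K] {p : ℕ}
    (α : TruncPoly K p →ₐ[K] GroupAlg K (K ⊗[k] A))
    (ρ : GroupAlg k A →ₐ[k] Module.End k V) : Prop :=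
  ¬ ∃ (L : Type w) (_ : Field L) (_ : Algebra k L)
      (β : TruncPoly L p →ₐ[L] GroupAlg L (L ⊗[k] A)), IsPiPoint β ∧
      ∃ a b : JordanType p, HasJordanType (restrict α ρ) a ∧ HasJordanType (restrict β ρ) b ∧
        b.StrictlyDominates a

end PiPoints

end FiniteGroupScheme

end

/-!
A `π`-point is determined by `x = α(t)`, a `p`-nilpotent element of the group algebra `KC` of a
unipotent abelian subgroup scheme `C`, and Jordan types are determined by the ranks of the powers of
`x` (`repIso_of_finrank_range_pow_eq`, `hasMaximalJordanType_iff`). On the dual module `M^#`, the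
powers of `x` have the ranks of the powers of `S(x)` on `M` (`rk_dual`), whereas on the dual formed
with `t ↦ -t` they have the ranks of `x` itself. So the point is to show that `-S(x)` is again the
image of `t` under a `π`-point, with the same ranks on `M` as `x` when those of `x` are maximal.

Two facts give this after passage to an algebraically closed field.

* `-S(x) = x + ∑ yᵢ zᵢ` with `yᵢ ^ p = 0` and `zᵢ` in the augmentation ideal `I` of `KC`
  (`neg_anti_sub_mem_nilProducts`). Indeed `D = Δ(x) - x ⊗ 1 - 1 ⊗ x` lies in `I ⊗ I` and has
  vanishing `p`-th power. Over a perfect field such tensors are sums of elements `y ⊗ z` and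
  `z ⊗ y` with `y ^ p = 0` (`mem_nilTensors_of_pow_eq_zero`), because the `p`-th powers of a basis
  of a complement of the `p`-nilpotent elements of `I` are linearly independent. Applying
  `f ⊗ g ↦ f S(g)` to `D` gives `-x - S(x)`.
* Replacing `x` by `x + y z`, with `y ^ p = 0` and `z ∈ I`, does not change maximal ranks
  (`IsMaximalRank.rk_map_add_mul`). The pencil `x + X y` over the rational function field is a
  `π`-point whose ranks are at least those of `x`, by semicontinuity, hence equal to them by
  maximality. So the rank of `(x + X y) ^ j` does not jump at `X = 0`. Then the cokernel of
  `(x + X y) ^ j` on `F[X] ⊗ M` has no `X`-power torsion, and as `z` is nilpotent the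
  substitution `X ↦ z` does not lower the rank either (`finrank_range_pow_le_of_pencil_le`).

The same argument on the regular representation, where the rank of `x ^ (p - 1)` is as large as
possible exactly when `α` is flat (`isLeftFlat_iff_rk`), shows without any maximality assumption
that `x + y z` again comes from a `π`-point (`IsPiElement.map_add_mul`).
-/

open scoped TensorProduct

noncomputable section

namespace FiniteGroupScheme

open Module Polynomial

/-! ### Ranks of endomorphisms under base change and conjugation -/

section BaseChangeRank

theorem finrank_range_baseChange {R : Type*} (S : Type*) {M N : Type*} [CommRing R] [IsDomain R]
    [IsPrincipalIdealRing R] [CommRing S] [Nontrivial S] [Algebra R S] [Module.Flat R S]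
    [AddCommGroup M] [Module R M] [AddCommGroup N] [Module R N] [Module.Free R N]
    [Module.Finite R N] (f : M →ₗ[R] N) :
    finrank S (LinearMap.range (f.baseChange S)) = finrank R (LinearMap.range f) := by
  have hf : f = (LinearMap.range f).subtype ∘ₗ f.rangeRestrict := rfl
  have h1 : Function.Injective ((LinearMap.range f).subtype.baseChange S) :=
    Module.Flat.lTensor_preserves_injective_linearMap (M := S) _ (Submodule.injective_subtype _)
  have h2 : Function.Surjective (f.rangeRestrict.baseChange S) :=
    LinearMap.lTensor_surjective S f.surjective_rangeRestrict
  conv_lhs => rw [hf]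
  rw [LinearMap.baseChange_comp, LinearMap.range_comp, LinearMap.range_eq_top.2 h2,
    Submodule.map_top, LinearMap.finrank_range_of_inj h1, Module.finrank_baseChange]

theorem finrank_range_conj {R : Type*} {M N : Type*} [CommRing R]
    [AddCommGroup M] [Module R M] [AddCommGroup N] [Module R N] (e : M ≃ₗ[R] N)
    (f : Module.End R M) (g : Module.End R N) (h : ∀ m, e (f m) = g (e m)) :
    finrank R (LinearMap.range f) = finrank R (LinearMap.range g) := by
  have : LinearMap.range g = (LinearMap.range f).map (e : M →ₗ[R] N) := by
    ext n
    simp only [LinearMap.mem_range, Submodule.mem_map, exists_exists_eq_and, LinearEquiv.coe_coe]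
    exact ⟨fun ⟨m, hm⟩ => ⟨e.symm m, by simp [h, hm]⟩, fun ⟨m, hm⟩ => ⟨e m, by rw [← h, hm]⟩⟩
  rw [this]
  exact (LinearEquiv.finrank_map_eq e _).symm

theorem finrank_range_pow_conj {R : Type*} {M N : Type*} [CommRing R]
    [AddCommGroup M] [Module R M] [AddCommGroup N] [Module R N] (e : M ≃ₗ[R] N)
    (f : Module.End R M) (g : Module.End R N) (h : ∀ m, e (f m) = g (e m)) (j : ℕ) :
    finrank R (LinearMap.range (f ^ j)) = finrank R (LinearMap.range (g ^ j)) := by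
  refine finrank_range_conj e _ _ fun m => ?_
  induction j with
  | zero => simp
  | succ j ih => rw [pow_succ', pow_succ', Module.End.mul_apply, Module.End.mul_apply, h, ih]

end BaseChangeRank

/-! ### Finitely generated modules over `F[X]` with a nilpotent endomorphism -/

section PolynomialModules

variable {F : Type*} [Field F]

/-- Reduction modulo `X` of the torsion free quotient of `C`: it is a surjection onto a space of
dimension the rank of `C`, killing `X C` and the torsion. -/
theorem exists_reduction_at_zero (C : Type*) [AddCommGroup C] [Module F C] [Module F[X] C]
    [IsScalarTower F F[X] C] [Module.Finite F[X] C] :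
    ∃ φ : C →ₗ[F] (Fin (finrank F[X] C) → F), Function.Surjective φ ∧
      (∀ m, φ ((X : F[X]) • m) = 0) ∧ ∀ m ∈ Submodule.torsion F[X] C, φ m = 0 := by
  let D := C ⧸ Submodule.torsion F[X] C
  have hD : finrank F[X] D = finrank F[X] C := by
    have h := Submodule.finrank_quotient_add_finrank (Submodule.torsion F[X] C)
    have h0 : finrank F[X] (Submodule.torsion F[X] C) = 0 :=
      Module.finrank_eq_zero_iff_isTorsion.2 (Submodule.torsion_isTorsion)
    rw [h0, add_zero] at h
    exact h
  let b : Basis (Fin (finrank F[X] C)) F[X] D := (Module.finBasis F[X] D).reindex (finCongr hD)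
  let φ₀ : D →ₗ[F[X]] (Fin (finrank F[X] C) → F[X]) := b.equivFun.toLinearMap
  let ev : (Fin (finrank F[X] C) → F[X]) →ₗ[F] (Fin (finrank F[X] C) → F) :=
    LinearMap.pi fun i => (Polynomial.lcoeff F 0) ∘ₗ LinearMap.proj i
  refine ⟨ev ∘ₗ (φ₀ ∘ₗ (Submodule.torsion F[X] C).mkQ).restrictScalars F, ?_, ?_, ?_⟩
  · intro v
    obtain ⟨m, hm⟩ := (Submodule.torsion F[X] C).mkQ_surjective
      (b.equivFun.symm (fun i => Polynomial.C (v i)))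
    refine ⟨m, ?_⟩
    ext i
    simp only [LinearMap.comp_apply, LinearMap.restrictScalars_apply, hm]
    change ((b.equivFun (b.equivFun.symm fun i => Polynomial.C (v i))) i).coeff 0 = v i
    rw [LinearEquiv.apply_symm_apply, Polynomial.coeff_C_zero]
  · intro m
    ext i
    simp [ev]
  · intro m hm
    have : (Submodule.torsion F[X] C).mkQ m = 0 := by simpa using hm
    simp [this]

/-- In a finite free `F[X]`-module the span of a basis is a complement of `X C` of dimension the
rank. -/
theorem exists_complement_of_free (C : Type*) [AddCommGroup C] [Module F C]
    [Module F[X] C] [IsScalarTower F F[X] C] [Module.Finite F[X] C] [Module.Free F[X] C] :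
    ∃ W : Submodule F C, Module.Finite F W ∧
      finrank F W ≤ finrank F[X] C ∧ ∀ m : C, ∃ w ∈ W, ∃ m', m = w + (X : F[X]) • m' := by
  let b := Module.finBasis F[X] C
  refine ⟨Submodule.span F (Set.range b), Module.Finite.span_of_finite F (Set.finite_range b),
    (finrank_range_le_card (R := F) b).trans_eq (by simp), fun m => ?_⟩
  refine ⟨∑ i, (b.repr m i).coeff 0 • b i, Submodule.sum_mem _ fun i _ =>
    Submodule.smul_mem _ _ (Submodule.subset_span ⟨i, rfl⟩), ∑ i, (b.repr m i).divX • b i, ?_⟩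
  conv_lhs => rw [← b.sum_repr m]
  simp only [Finset.smul_sum, ← Finset.sum_add_distrib, smul_smul]
  refine Finset.sum_congr rfl fun i _ => ?_
  conv_lhs => rw [← Polynomial.divX_mul_X_add (b.repr m i)]
  rw [add_smul, add_comm, mul_comm]
  congr 1
  rw [← Polynomial.algebraMap_eq, algebraMap_smul]

/-- For a nilpotent endomorphism `z` of a torsion free module `C`, the cokernel of `X - z` has
dimension at most the rank of `C`. This is an induction over `0 → ker z → C → z C → 0`, where
`X - z` acts on `ker z` as `X`. -/
theorem exists_complement_of_torsionFree (n : ℕ) : ∀ (C : Type*) [AddCommGroup C] [Module F C]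
    [Module F[X] C] [IsScalarTower F F[X] C] [Module.Finite F[X] C] [Module.IsTorsionFree F[X] C]
    (z : C →ₗ[F[X]] C), z ^ n = 0 → ∃ W : Submodule F C, Module.Finite F W ∧
      finrank F W ≤ finrank F[X] C ∧ ∀ m : C, ∃ w ∈ W, ∃ m', m = w + ((X : F[X]) • m' - z m') := by
  induction n with
  | zero =>
    intro C _ _ _ _ _ _ z hz
    refine ⟨⊥, inferInstance, by simp, fun m => ⟨0, by simp, 0, ?_⟩⟩
    simpa using LinearMap.congr_fun hz m
  | succ n ih =>
    intro C _ _ _ _ _ _ z hz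
    let N := LinearMap.range z
    have hzN : ∀ m ∈ N, z m ∈ N := fun m _ => ⟨m, rfl⟩
    let z' : N →ₗ[F[X]] N := z.restrict hzN
    have hz'k : ∀ (k : ℕ) (m : N), (((z' ^ k) m : N) : C) = (z ^ k) m := by
      intro k m
      induction k with
      | zero => simp
      | succ k ihk => rw [pow_succ', pow_succ']; simp only [Module.End.mul_apply]; rw [← ihk]; rfl
    have hz' : z' ^ n = 0 := by
      ext ⟨m, m', rfl⟩
      rw [hz'k]
      change (z ^ n) (z m') = 0
      rw [← Module.End.mul_apply, ← pow_succ, hz]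
      rfl
    obtain ⟨W₁, hW₁, hr₁, h₁⟩ := ih N z' hz'
    let Kr := LinearMap.ker z
    obtain ⟨W₂, hW₂, hr₂, h₂⟩ := exists_complement_of_free (F := F) Kr
    let ι : Kr →ₗ[F] C := Kr.subtype.restrictScalars F
    -- a section of `z` over `W₁`
    obtain ⟨s, hs⟩ := (z.rangeRestrict.restrictScalars F).exists_rightInverse_of_surjective
      (LinearMap.range_eq_top.2 z.surjective_rangeRestrict)
    refine ⟨W₂.map ι ⊔ W₁.map s, inferInstance, ?_, ?_⟩
    · have h1 : finrank F (W₂.map ι) ≤ finrank F W₂ := Submodule.finrank_map_le _ _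
      have h2 : finrank F (W₁.map s) ≤ finrank F W₁ := Submodule.finrank_map_le _ _
      have h3 := Submodule.finrank_add_le_finrank_add_finrank (W₂.map ι) (W₁.map s)
      have h4 : finrank F[X] N + finrank F[X] Kr = finrank F[X] C := by
        rw [← z.quotKerEquivRange.finrank_eq]
        exact Submodule.finrank_quotient_add_finrank Kr
      exact h3.trans ((add_le_add (h1.trans hr₂) (h2.trans hr₁)).trans_eq
        ((add_comm _ _).trans h4))
    · intro m
      obtain ⟨w, hw, ⟨_, m', rfl⟩, hm⟩ := h₁ ⟨z m, m, rfl⟩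
      have hm2 : z m = w + ((X : F[X]) • z m' - z (z m')) := congrArg Subtype.val hm
      have hsw : z (s w) = w := congrArg Subtype.val (LinearMap.congr_fun hs w)
      have hk : m - s w - ((X : F[X]) • m' - z m') ∈ Kr := by
        simp only [Kr, LinearMap.mem_ker, map_sub, map_smul, hsw]
        rw [hm2]; abel
      obtain ⟨u, hu, m'', hm''⟩ := h₂ ⟨_, hk⟩
      refine ⟨ι u + s w, Submodule.add_mem_sup ⟨u, hu, rfl⟩ ⟨w, hw, rfl⟩, m' + m'', ?_⟩
      have hz0 : z m'' = 0 := m''.2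
      have hm3 : m - s w - ((X : F[X]) • m' - z m') = ι u + (X : F[X]) • (m'' : C) :=
        congrArg Subtype.val hm''
      rw [map_add, smul_add, hz0]
      have : m = ι u + (X : F[X]) • (m'' : C) + s w + ((X : F[X]) • m' - z m') := by
        rw [← hm3]; abel
      rw [this]; abel

/-- If the dimension of `C / X C` does not exceed the rank of `C`, then the torsion of `C` satisfies
`T = X T`, so `X - z` is surjective on `T` for nilpotent `z`, and the cokernel of `X - z` has
dimension at most the rank of `C`, as in the torsion free case. -/
theorem exists_complement_of_finrank_le {C U : Type*} [AddCommGroup C] [Module F C]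
    [Module F[X] C] [IsScalarTower F F[X] C] [Module.Finite F[X] C] [AddCommGroup U] [Module F U]
    [Module.Finite F U] (z : C →ₗ[F[X]] C) (hz : IsNilpotent z)
    (ψ : C →ₗ[F] U) (hψ : Function.Surjective ψ)
    (hker : ∀ m, ψ m = 0 → ∃ m', m = (X : F[X]) • m') (hU : finrank F U ≤ finrank F[X] C) :
    ∃ W : Submodule F C, Module.Finite F W ∧
      finrank F W ≤ finrank F[X] C ∧ ∀ m : C, ∃ w ∈ W, ∃ m', m = w + ((X : F[X]) • m' - z m') := by
  obtain ⟨φ, hφ, hφX, hφT⟩ := exists_reduction_at_zero (F := F) C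
  let T := Submodule.torsion F[X] C
  -- `φ` factors through `ψ`, and the factorization is injective by dimension
  obtain ⟨s, hs⟩ := ψ.exists_rightInverse_of_surjective (LinearMap.range_eq_top.2 hψ)
  have hfac : ∀ m, φ (s (ψ m)) = φ m := by
    intro m
    obtain ⟨m', hm'⟩ := hker (m - s (ψ m)) (by
      rw [map_sub, sub_eq_zero]; exact (LinearMap.congr_fun hs (ψ m)).symm)
    have := hφX m'
    rw [← hm', map_sub, sub_eq_zero] at this
    exact this.symm
  have hsurj : Function.Surjective (φ ∘ₗ s) := fun v => by
    obtain ⟨m, rfl⟩ := hφ v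
    exact ⟨ψ m, hfac m⟩
  have hdim : finrank F U = finrank F (Fin (finrank F[X] C) → F) := by
    apply le_antisymm
    · simpa using hU
    · exact LinearMap.finrank_le_finrank_of_surjective hsurj
  have hinj : Function.Injective (φ ∘ₗ s) :=
    (LinearMap.injective_iff_surjective_of_finrank_eq_finrank hdim).2 hsurj
  have hTX : ∀ t ∈ T, ∃ t' ∈ T, t = (X : F[X]) • t' := by
    intro t ht
    have h0 : ψ t = 0 := hinj (by
      rw [map_zero]
      exact (hfac t).trans (hφT t ht))
    obtain ⟨t', rfl⟩ := hker t h0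
    refine ⟨t', ?_, rfl⟩
    obtain ⟨⟨a, ha⟩, hat⟩ := (Submodule.mem_torsion_iff _).1 ht
    refine (Submodule.mem_torsion_iff _).2 ⟨⟨a * X, mul_mem ha
      (mem_nonZeroDivisors_of_ne_zero Polynomial.X_ne_zero)⟩, ?_⟩
    simpa [Submonoid.smul_def, mul_smul] using hat
  have hTz : ∀ t ∈ T, z t ∈ T := by
    intro t ht
    obtain ⟨a, hat⟩ := (Submodule.mem_torsion_iff _).1 ht
    refine (Submodule.mem_torsion_iff _).2 ⟨a, ?_⟩
    rw [Submonoid.smul_def] at hat ⊢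
    rw [← map_smul, hat, map_zero]
  have hT : ∀ t ∈ T, ∃ t', t = (X : F[X]) • t' - z t' := by
    obtain ⟨n, hn⟩ := hz
    have key : ∀ k : ℕ, ∀ t ∈ T, ∃ t' : C, ∃ t'' ∈ T,
        t = ((X : F[X]) • t' - z t') + (z ^ k) t'' := by
      intro k
      induction k with
      | zero => exact fun t ht => ⟨0, t, ht, by simp⟩
      | succ k ih =>
        intro t ht
        obtain ⟨t', t'', ht'', h⟩ := ih t ht
        obtain ⟨u, hu, rfl⟩ := hTX t'' ht''
        refine ⟨t' + (z ^ k) u, u, hu, ?_⟩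
        rw [h, map_smul, pow_succ', Module.End.mul_apply, map_add, smul_add]
        abel
    intro t ht
    obtain ⟨t', t'', _, h⟩ := key n t ht
    exact ⟨t', by simpa [hn] using h⟩
  -- pass to the torsion free quotient
  let z' : (C ⧸ T) →ₗ[F[X]] (C ⧸ T) := T.mapQ T z hTz
  have hz'k : ∀ (k : ℕ) (m : C), (z' ^ k) (T.mkQ m) = T.mkQ ((z ^ k) m) := by
    intro k m
    induction k with
    | zero => simp
    | succ k ih => rw [pow_succ', pow_succ']; simp only [Module.End.mul_apply]; rw [ih]; rfl
  obtain ⟨n, hn⟩ := hz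
  have hz' : z' ^ n = 0 := by
    ext m
    rw [LinearMap.comp_apply, hz'k, hn]
    simp
  have hD : finrank F[X] (C ⧸ T) ≤ finrank F[X] C := by
    have h := Submodule.finrank_quotient_add_finrank T
    omega
  obtain ⟨W, hW, hr, h⟩ := exists_complement_of_torsionFree n (C ⧸ T) z' hz'
  obtain ⟨r, hr'⟩ := (T.mkQ.restrictScalars F).exists_rightInverse_of_surjective
      (LinearMap.range_eq_top.2 T.mkQ_surjective)
  refine ⟨W.map r, inferInstance, (Submodule.finrank_map_le _ _).trans (hr.trans hD), fun m => ?_⟩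
  obtain ⟨w, hw, m', hm⟩ := h (T.mkQ m)
  obtain ⟨m', rfl⟩ := T.mkQ_surjective m'
  have hw' : T.mkQ (r w) = w := LinearMap.congr_fun hr' w
  have hmT : m - r w - ((X : F[X]) • m' - z m') ∈ T := by
    refine (Submodule.Quotient.mk_eq_zero T).1 ?_
    rw [← Submodule.mkQ_apply, map_sub, map_sub, hw', map_sub, map_smul, hm]
    change _ - _ - (_ - z' (T.mkQ m')) = 0
    abel
  obtain ⟨t', ht'⟩ := hT _ hmT
  refine ⟨r w, ⟨w, hw, rfl⟩, m' + t', ?_⟩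
  rw [map_add, smul_add]
  have : m = ((X : F[X]) • t' - z t') + r w + ((X : F[X]) • m' - z m') := by
    rw [← ht']; abel
  rw [this]; abel

end PolynomialModules

/-! ### Ranks in a pencil of endomorphisms -/

section Pencil

variable {F : Type*} [Field F] {V : Type*} [AddCommGroup V] [Module F V]

/-- The substitution `F[X] ⊗ V → V`, `f ⊗ v ↦ f(z) v`, for an endomorphism `z` of `V`. -/
def evalAt (z : Module.End F V) : F[X] ⊗[F] V →ₗ[F] V :=
  TensorProduct.lift (Polynomial.aeval z).toLinearMap

theorem evalAt_tmul (z : Module.End F V) (f : F[X]) (v : V) :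
    evalAt z (f ⊗ₜ v) = Polynomial.aeval z f v := rfl

theorem evalAt_X_smul (z : Module.End F V) (m : F[X] ⊗[F] V) :
    evalAt z ((X : F[X]) • m) = z (evalAt z m) := by
  induction m using TensorProduct.induction_on with
  | zero => simp
  | add a b ha hb => simp only [smul_add, map_add, ha, hb]
  | tmul f v => simp [TensorProduct.smul_tmul', evalAt_tmul]

theorem evalAt_baseChange {z x : Module.End F V} (h : Commute x z) (m : F[X] ⊗[F] V) :
    evalAt z (x.baseChange F[X] m) = x (evalAt z m) := by
  induction m using TensorProduct.induction_on with
  | zero => simp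
  | add a b ha hb => simp only [map_add, ha, hb]
  | tmul f v =>
    have : Commute x (Polynomial.aeval z f) := by
      induction f using Polynomial.induction_on' with
      | add p q hp hq => rw [map_add]; exact hp.add_right hq
      | monomial n a =>
        rw [Polynomial.aeval_monomial]
        exact (Algebra.commute_algebraMap_right a x).mul_right (h.pow_right n)
    exact (LinearMap.congr_fun this v).symm

theorem evalAt_surjective (z : Module.End F V) : Function.Surjective (evalAt z) := fun v =>
  ⟨1 ⊗ₜ v, by simp [evalAt_tmul]⟩

theorem exists_eq_tmul_evalAt_zero_add (m : F[X] ⊗[F] V) :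
    ∃ m', m = (1 : F[X]) ⊗ₜ evalAt 0 m + (X : F[X]) • m' := by
  induction m using TensorProduct.induction_on with
  | zero => exact ⟨0, by simp⟩
  | add a b ha hb =>
    obtain ⟨a', ha'⟩ := ha
    obtain ⟨b', hb'⟩ := hb
    refine ⟨a' + b', ?_⟩
    rw [map_add, TensorProduct.tmul_add, smul_add]
    nth_rw 1 [ha', hb']
    abel
  | tmul f v =>
    refine ⟨f.divX ⊗ₜ v, ?_⟩
    have h0 : Polynomial.aeval (0 : Module.End F V) f = algebraMap F _ (f.coeff 0) := by
      rw [Polynomial.aeval_def, Polynomial.eval₂_at_zero]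
    rw [evalAt_tmul, h0, Module.algebraMap_end_apply, TensorProduct.smul_tmul',
      ← TensorProduct.smul_tmul, ← TensorProduct.add_tmul,
      smul_eq_mul, mul_comm X, Polynomial.smul_eq_C_mul, mul_one, add_comm,
      Polynomial.divX_mul_X_add]

/-- The pencil `x + X y`, an endomorphism of `F[X] ⊗ V`. -/
def pencil (x y : Module.End F V) : Module.End F[X] (F[X] ⊗[F] V) :=
  x.baseChange F[X] + (X : F[X]) • y.baseChange F[X]

theorem evalAt_pencil_pow {x y z : Module.End F V} (hxz : Commute x z) (hyz : Commute y z)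
    (j : ℕ) (m : F[X] ⊗[F] V) :
    evalAt z ((pencil x y ^ j) m) = ((x + y * z) ^ j) (evalAt z m) := by
  induction j with
  | zero => simp
  | succ j ih =>
    rw [pow_succ', pow_succ', Module.End.mul_apply, Module.End.mul_apply, ← ih]
    simp only [pencil, LinearMap.add_apply, map_add, LinearMap.smul_apply, evalAt_X_smul,
      evalAt_baseChange hxz, evalAt_baseChange hyz]
    rw [hyz.eq]
    rfl

theorem evalAt_zero_pencil_pow (x y : Module.End F V) (j : ℕ) (m : F[X] ⊗[F] V) :
    evalAt 0 ((pencil x y ^ j) m) = (x ^ j) (evalAt 0 m) := by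
  have := evalAt_pencil_pow (Commute.zero_right x) (Commute.zero_right y) j m
  rwa [mul_zero, add_zero] at this

variable [FiniteDimensional F V]

theorem finrank_add_finrank_coker_pencil (x y : Module.End F V) (j : ℕ) :
    finrank F[X] ((F[X] ⊗[F] V) ⧸ LinearMap.range (pencil x y ^ j)) +
      finrank F[X] (LinearMap.range (pencil x y ^ j)) = finrank F V := by
  rw [Submodule.finrank_quotient_add_finrank, Module.finrank_baseChange]

/-- Semicontinuity of the rank in the pencil `x + X y`. -/
theorem finrank_range_pow_le_pencil (x y : Module.End F V) (j : ℕ) :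
    finrank F (LinearMap.range (x ^ j)) ≤ finrank F[X] (LinearMap.range (pencil x y ^ j)) := by
  let C := (F[X] ⊗[F] V) ⧸ LinearMap.range (pencil x y ^ j)
  obtain ⟨φ, hφ, hφX, -⟩ := exists_reduction_at_zero (F := F) C
  let mk : F[X] ⊗[F] V →ₗ[F] C :=
    (LinearMap.range (pencil x y ^ j)).mkQ.restrictScalars F
  let inc : V →ₗ[F] F[X] ⊗[F] V := TensorProduct.mk F F[X] V 1
  have hinc : ∀ m, φ (mk m) = φ (mk (inc (evalAt 0 m))) := by
    intro m
    obtain ⟨m', hm'⟩ := exists_eq_tmul_evalAt_zero_add m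
    conv_lhs => rw [hm']
    rw [map_add, map_add]
    have : mk ((X : F[X]) • m') = (X : F[X]) • mk m' := rfl
    rw [this, hφX, add_zero]
    rfl
  have hker : ∀ v ∈ LinearMap.range (x ^ j), (φ ∘ₗ mk ∘ₗ inc) v = 0 := by
    rintro _ ⟨v, rfl⟩
    have h1 : evalAt 0 ((pencil x y ^ j) (inc v)) = (x ^ j) v := by
      rw [evalAt_zero_pencil_pow]
      simp [inc, evalAt_tmul]
    rw [← h1]
    change φ (mk (inc _)) = 0
    rw [← hinc]
    have : mk ((pencil x y ^ j) (inc v)) = 0 :=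
      (Submodule.Quotient.mk_eq_zero _).2 ⟨_, rfl⟩
    rw [this, map_zero]
  have hsurj : Function.Surjective ((LinearMap.range (x ^ j)).liftQ (φ ∘ₗ mk ∘ₗ inc)
      (fun v hv => hker v hv)) := by
    intro w
    obtain ⟨c, rfl⟩ := hφ w
    obtain ⟨m, rfl⟩ := (LinearMap.range (pencil x y ^ j)).mkQ_surjective c
    exact ⟨Submodule.Quotient.mk (evalAt 0 m), (hinc m).symm⟩
  have h1 := LinearMap.finrank_le_finrank_of_surjective hsurj
  have h2 := Submodule.finrank_quotient_add_finrank (LinearMap.range (x ^ j))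
  have h3 := finrank_add_finrank_coker_pencil x y j
  rw [Module.finrank_fin_fun] at h1
  simp only [C] at h1
  omega

/-- If the rank of `(x + X y) ^ j` does not jump at `X = 0`, then it does not drop when a nilpotent
operator `z` commuting with `x` and `y` is substituted for `X`. -/
theorem finrank_range_pow_le_of_pencil_le {x y z : Module.End F V} (hxz : Commute x z)
    (hyz : Commute y z) (hz : IsNilpotent z) (j : ℕ)
    (h : finrank F[X] (LinearMap.range (pencil x y ^ j)) ≤ finrank F (LinearMap.range (x ^ j))) :
    finrank F (LinearMap.range (x ^ j)) ≤ finrank F (LinearMap.range ((x + y * z) ^ j)) := by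
  let Rg := LinearMap.range (pencil x y ^ j)
  let C := (F[X] ⊗[F] V) ⧸ Rg
  let mk : F[X] ⊗[F] V →ₗ[F] C := Rg.mkQ.restrictScalars F
  have hmk : Function.Surjective mk := Rg.mkQ_surjective
  let zh : Module.End F[X] (F[X] ⊗[F] V) := z.baseChange F[X]
  have hcomm : Commute zh (pencil x y ^ j) := by
    refine Commute.pow_right ?_ j
    have h1 : Commute zh (x.baseChange F[X]) := by
      have := congrArg (LinearMap.baseChange F[X]) hxz.eq
      rw [LinearMap.baseChange_mul, LinearMap.baseChange_mul] at this
      exact this.symm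
    have h2 : Commute zh (y.baseChange F[X]) := by
      have := congrArg (LinearMap.baseChange F[X]) hyz.eq
      rw [LinearMap.baseChange_mul, LinearMap.baseChange_mul] at this
      exact this.symm
    exact h1.add_right (h2.smul_right X)
  have hst : Rg ≤ Rg.comap zh := by
    rintro _ ⟨m, rfl⟩
    exact ⟨zh m, (LinearMap.congr_fun hcomm.eq m).symm⟩
  let zC : C →ₗ[F[X]] C := Rg.mapQ Rg zh hst
  have hzCk : ∀ (k : ℕ) (m), (zC ^ k) (Rg.mkQ m) = Rg.mkQ ((zh ^ k) m) := by
    intro k m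
    induction k with
    | zero => simp
    | succ k ihk => rw [pow_succ', pow_succ']; simp only [Module.End.mul_apply]; rw [ihk]; rfl
  have hzC : IsNilpotent zC := by
    obtain ⟨n, hn⟩ := hz
    refine ⟨n, ?_⟩
    apply LinearMap.ext
    intro c
    obtain ⟨m, rfl⟩ := Rg.mkQ_surjective c
    have : zh ^ n = 0 := by
      simp only [zh]
      rw [← LinearMap.baseChange_pow, hn, LinearMap.baseChange_zero]
    rw [hzCk, this]
    simp
  let U := V ⧸ LinearMap.range (x ^ j)
  let ψ : C →ₗ[F] U := (Rg.restrictScalars F).liftQ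
    ((LinearMap.range (x ^ j)).mkQ ∘ₗ evalAt 0) (by
      rintro _ ⟨m, rfl⟩
      rw [LinearMap.mem_ker, LinearMap.comp_apply, evalAt_zero_pencil_pow]
      exact (Submodule.Quotient.mk_eq_zero _).2 ⟨_, rfl⟩)
  have hψmk : ∀ m, ψ (mk m) = (LinearMap.range (x ^ j)).mkQ (evalAt 0 m) := fun _ => rfl
  have hψ : Function.Surjective ψ := fun u => by
    obtain ⟨v, rfl⟩ := (LinearMap.range (x ^ j)).mkQ_surjective u
    obtain ⟨m, rfl⟩ := evalAt_surjective (0 : Module.End F V) v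
    exact ⟨mk m, rfl⟩
  have hker : ∀ c, ψ c = 0 → ∃ c', c = (X : F[X]) • c' := by
    intro c hc
    obtain ⟨m, rfl⟩ := hmk c
    rw [hψmk] at hc
    obtain ⟨v, hv⟩ := (Submodule.Quotient.mk_eq_zero _).1 hc
    -- subtracting an element of the range of the pencil makes `m` vanish at `X = 0`
    obtain ⟨m', hm'⟩ := exists_eq_tmul_evalAt_zero_add (m - (pencil x y ^ j) ((1 : F[X]) ⊗ₜ v))
    have h0 : evalAt 0 (m - (pencil x y ^ j) ((1 : F[X]) ⊗ₜ v)) = 0 := by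
      rw [map_sub, evalAt_zero_pencil_pow, evalAt_tmul, ← hv]
      simp
    rw [h0, TensorProduct.tmul_zero, zero_add] at hm'
    refine ⟨mk m', ?_⟩
    have h1 : mk (m - (pencil x y ^ j) ((1 : F[X]) ⊗ₜ v)) = mk m := by
      rw [map_sub, sub_eq_self]
      exact (Submodule.Quotient.mk_eq_zero _).2 ⟨_, rfl⟩
    rw [← h1, hm']
    rfl
  have h2 := Submodule.finrank_quotient_add_finrank (LinearMap.range (x ^ j))
  have h3 := finrank_add_finrank_coker_pencil x y j
  have hU : finrank F U ≤ finrank F[X] C := by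
    have h4 : finrank F U + finrank F (LinearMap.range (x ^ j)) = finrank F V := h2
    have h5 : finrank F[X] C + finrank F[X] (LinearMap.range (pencil x y ^ j)) = finrank F V := h3
    omega
  obtain ⟨W, hW, hr, hWs⟩ := exists_complement_of_finrank_le zC hzC ψ hψ hker hU
  -- `W` surjects onto the cokernel of `(x + y z) ^ j`
  let Q := V ⧸ LinearMap.range ((x + y * z) ^ j)
  let θ : C →ₗ[F] Q := (Rg.restrictScalars F).liftQ
    ((LinearMap.range ((x + y * z) ^ j)).mkQ ∘ₗ evalAt z) (by
      rintro _ ⟨m, rfl⟩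
      rw [LinearMap.mem_ker, LinearMap.comp_apply, evalAt_pencil_pow hxz hyz]
      exact (Submodule.Quotient.mk_eq_zero _).2 ⟨_, rfl⟩)
  have hθmk : ∀ m, θ (mk m) = (LinearMap.range ((x + y * z) ^ j)).mkQ (evalAt z m) := fun _ => rfl
  have hθW : Function.Surjective (θ ∘ₗ W.subtype) := by
    intro q
    obtain ⟨v, rfl⟩ := (LinearMap.range ((x + y * z) ^ j)).mkQ_surjective q
    obtain ⟨m, rfl⟩ := evalAt_surjective z v
    obtain ⟨w, hw, c', hc⟩ := hWs (mk m)
    obtain ⟨m', rfl⟩ := hmk c'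
    refine ⟨⟨w, hw⟩, ?_⟩
    change θ w = _
    rw [← hθmk, hc, map_add]
    have : θ ((X : F[X]) • mk m' - zC (mk m')) = 0 := by
      have h4 : (X : F[X]) • mk m' - zC (mk m') = mk ((X : F[X]) • m' - zh m') := rfl
      rw [h4, hθmk, map_sub, evalAt_X_smul, evalAt_baseChange (Commute.refl z), sub_self, map_zero]
    rw [this, add_zero]
  have h5 := LinearMap.finrank_le_finrank_of_surjective hθW
  have h6 : finrank F Q + finrank F (LinearMap.range ((x + y * z) ^ j)) = finrank F V :=
    Submodule.finrank_quotient_add_finrank (LinearMap.range ((x + y * z) ^ j))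
  have h7 : finrank F[X] C + finrank F[X] (LinearMap.range (pencil x y ^ j)) = finrank F V := h3
  have h8 := finrank_range_pow_le_pencil x y j
  omega

/-- The generic rank of the pencil is its rank over a field containing `F[X]`. -/
theorem finrank_range_pencil (L : Type*) [Field L] [Algebra F L] [Algebra F[X] L]
    [IsScalarTower F F[X] L] [Module.Flat F[X] L] (x y : Module.End F V) (j : ℕ) :
    finrank L (LinearMap.range ((x.baseChange L +
      algebraMap F[X] L X • y.baseChange L) ^ j)) =
      finrank F[X] (LinearMap.range (pencil x y ^ j)) := by
  rw [← finrank_range_baseChange L (pencil x y ^ j), LinearMap.baseChange_pow]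
  symm
  let e : L ⊗[F[X]] (F[X] ⊗[F] V) ≃ₗ[L] L ⊗[F] V :=
    TensorProduct.AlgebraTensorModule.cancelBaseChange F F[X] L L V
  have h1 : ∀ m, e ((pencil x y).baseChange L m) =
      (x.baseChange L + algebraMap F[X] L X • y.baseChange L) (e m) := by
    intro m
    induction m using TensorProduct.induction_on with
    | zero => simp
    | add a b ha hb => simp only [map_add, ha, hb]
    | tmul l m =>
      induction m using TensorProduct.induction_on with
      | zero => simp
      | add a b ha hb => simp only [TensorProduct.tmul_add, map_add, ha, hb]
      | tmul f v =>
        simp [e, pencil, TensorProduct.smul_tmul', Algebra.smul_def,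
          mul_comm, mul_left_comm]
  exact finrank_range_pow_conj e _ _ h1 j

end Pencil

/-! ### Jordan types and ranks -/

section JordanTypes

variable {K : Type*} [Field K] {p : ℕ}

theorem TruncPoly.t_pow_eq_zero : TruncPoly.t K p ^ p = 0 := by
  rw [TruncPoly.t, ← map_pow, Ideal.Quotient.eq_zero_iff_mem]
  exact Ideal.mem_span_singleton_self _

theorem TruncPoly.map_mk {H : Type*} [Ring H] [Algebra K H] (f : TruncPoly K p →ₐ[K] H)
    (q : K[X]) : f (Ideal.Quotient.mk _ q) = Polynomial.aeval (f (TruncPoly.t K p)) q := by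
  have : f.comp (Ideal.Quotient.mkₐ K _) = Polynomial.aeval (f (TruncPoly.t K p)) := by
    ext
    simp [TruncPoly.t]
  exact DFunLike.congr_fun this q

/-- The algebra map `K[t]/t^p → H` with `t ↦ x`, for `x` with `x ^ p = 0`. -/
def TruncPoly.lift {H : Type*} [Ring H] [Algebra K H] (x : H) (hx : x ^ p = 0) :
    TruncPoly K p →ₐ[K] H :=
  Ideal.Quotient.liftₐ _ (Polynomial.aeval x) (by
    intro a ha
    obtain ⟨b, rfl⟩ := Ideal.mem_span_singleton'.1 ha
    rw [map_mul, map_pow, Polynomial.aeval_X, hx, mul_zero])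

@[simp]
theorem TruncPoly.lift_t {H : Type*} [Ring H] [Algebra K H] (x : H) (hx : x ^ p = 0) :
    TruncPoly.lift x hx (TruncPoly.t K p) = x := by
  change Polynomial.aeval x Polynomial.X = x
  simp

theorem TruncPoly.algHom_ext {H : Type*} [Ring H] [Algebra K H] {f g : TruncPoly K p →ₐ[K] H}
    (h : f (TruncPoly.t K p) = g (TruncPoly.t K p)) : f = g := by
  ext x
  obtain ⟨q, rfl⟩ := Ideal.Quotient.mk_surjective x
  rw [TruncPoly.map_mk, TruncPoly.map_mk, h]

variable {W : Type*} [AddCommGroup W] [Module K W] {W' : Type*} [AddCommGroup W'] [Module K W']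

theorem repIso_of_commutes {σ : TruncPoly K p →ₐ[K] Module.End K W}
    {τ : TruncPoly K p →ₐ[K] Module.End K W'} (e : W ≃ₗ[K] W')
    (h : ∀ w, e (σ (TruncPoly.t K p) w) = τ (TruncPoly.t K p) (e w)) : RepIso σ τ := by
  refine ⟨e, fun x v => ?_⟩
  obtain ⟨q, rfl⟩ := Ideal.Quotient.mk_surjective x
  rw [TruncPoly.map_mk, TruncPoly.map_mk]
  induction q using Polynomial.induction_on' with
  | add f g hf hg => simp only [map_add, LinearMap.add_apply, hf, hg]
  | monomial n a =>
    simp only [Polynomial.aeval_monomial, Module.End.mul_apply, Module.algebraMap_end_apply,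
      map_smul]
    congr 1
    induction n with
    | zero => simp
    | succ n ih =>
      rw [pow_succ', pow_succ', Module.End.mul_apply, Module.End.mul_apply, h, ih]

theorem pow_apply_of_isJordanBasis {ι : Type*} {s : ι → ℕ} {N : Module.End K W}
    {b : (Σ i, Fin (s i)) → W}
    (hb : ∀ i (l : Fin (s i)), N (b ⟨i, l⟩) = if h : l.val + 1 < s i then b ⟨i, ⟨l + 1, h⟩⟩ else 0)
    (j : ℕ) (i : ι) (l : Fin (s i)) :
    (N ^ j) (b ⟨i, l⟩) = if h : l.val + j < s i then b ⟨i, ⟨l + j, h⟩⟩ else 0 := by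
  induction j generalizing l with
  | zero => simp
  | succ j ih =>
    rw [pow_succ, Module.End.mul_apply, hb]
    by_cases h : l.val + 1 < s i
    · rw [dif_pos h, ih]
      simp only [show l.val + 1 + j = l.val + (j + 1) by omega]
    · rw [dif_neg h, map_zero, dif_neg (by omega)]

theorem finrank_range_pow_of_isJordanBasis {ι : Type*} [Fintype ι] {s : ι → ℕ}
    {N : Module.End K W} (b : Basis (Σ i, Fin (s i)) K W)
    (hb : ∀ i (l : Fin (s i)), N (b ⟨i, l⟩) = if h : l.val + 1 < s i then b ⟨i, ⟨l + 1, h⟩⟩ else 0)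
    (j : ℕ) : finrank K (LinearMap.range (N ^ j)) = ∑ i, (s i - j) := by
  let g : (Σ i, Fin (s i - j)) → (Σ i, Fin (s i)) := fun x => ⟨x.1, ⟨x.2.val + j, by omega⟩⟩
  have hg : Function.Injective g := by
    rintro ⟨i, l⟩ ⟨i', l'⟩ h
    simp only [g, Sigma.mk.injEq] at h
    obtain ⟨rfl, h⟩ := h
    simp only [heq_eq_eq, Fin.mk.injEq, Nat.add_right_cancel_iff] at h
    simp [Fin.ext_iff, h]
  have hrange : LinearMap.range (N ^ j) = Submodule.span K (Set.range (b ∘ g)) := by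
    rw [LinearMap.range_eq_map, ← b.span_eq, Submodule.map_span]
    apply le_antisymm
    · rw [Submodule.span_le]
      rintro _ ⟨_, ⟨⟨i, l⟩, rfl⟩, rfl⟩
      rw [pow_apply_of_isJordanBasis hb]
      split_ifs with h
      · exact Submodule.subset_span ⟨⟨i, ⟨l, by omega⟩⟩, rfl⟩
      · exact zero_mem _
    · rw [Submodule.span_le]
      rintro _ ⟨⟨i, l⟩, rfl⟩
      refine Submodule.subset_span ⟨b ⟨i, ⟨l, by omega⟩⟩, ⟨_, rfl⟩, ?_⟩
      rw [pow_apply_of_isJordanBasis hb, dif_pos (show l.val + j < s i by omega)]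
      rfl
  rw [hrange, finrank_span_eq_card (b.linearIndependent.comp g hg)]
  simp

theorem HasJordanType.finrank_range_pow {σ : TruncPoly K p →ₐ[K] Module.End K W}
    {a : JordanType p} (h : HasJordanType σ a) (j : ℕ) :
    finrank K (LinearMap.range (σ (TruncPoly.t K p) ^ j)) = a.tail j := by
  obtain ⟨b, hb⟩ := h
  let e : (Σ i : Fin p, Fin (a i) × Fin (i.val + 1)) ≃
      (Σ x : (Σ i : Fin p, Fin (a i)), Fin (x.1.val + 1)) :=
    { toFun := fun x => ⟨⟨x.1, x.2.1⟩, x.2.2⟩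
      invFun := fun x => ⟨x.1.1, x.1.2, x.2⟩
      left_inv := fun _ => rfl
      right_inv := fun _ => rfl }
  rw [finrank_range_pow_of_isJordanBasis (s := fun x : (Σ i : Fin p, Fin (a i)) => x.1.val + 1)
    (b.reindex e)]
  · rw [JordanType.tail, Fintype.sum_sigma]
    simp [mul_comm]
  · rintro ⟨i, c⟩ l
    simp only [Basis.reindex_apply]
    exact hb i c l

/-- The block numbers are second differences of the numbers of boxes outside the first columns. -/
theorem JordanType.tail_add_tail (a : JordanType p) (i : Fin p) :
    a.tail i.val + a.tail (i.val + 2) = a i + 2 * a.tail (i.val + 1) := by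
  have h : a i = ∑ i' : Fin p, if i' = i then a i' else 0 := by simp
  rw [h]
  simp only [JordanType.tail, Finset.mul_sum, ← Finset.sum_add_distrib]
  refine Finset.sum_congr rfl fun i' _ => ?_
  by_cases hi : i' = i
  · subst hi
    simp
  · have hi' : i'.val ≠ i.val := fun h => hi (Fin.ext h)
    rw [if_neg hi, zero_add, ← mul_assoc, ← add_mul]
    congr 1
    omega

theorem JordanType.eq_of_tail_eq {a b : JordanType p} (h : ∀ j, a.tail j = b.tail j) : a = b := by
  funext i
  have h1 := a.tail_add_tail i
  have h2 := b.tail_add_tail i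
  rw [h, h, h] at h1
  omega

theorem exists_quotient_X_pow_basis (n : ℕ) :
    ∃ b : Basis (Fin n) K (K[X] ⧸ (K[X] ∙ (X : K[X]) ^ n)),
    ∀ l : Fin n, b l = Submodule.Quotient.mk ((X : K[X]) ^ l.val) := by
  have hm : ((X : K[X]) ^ n).Monic := monic_X_pow n
  let b := (AdjoinRoot.powerBasis' hm).basis
  have hd : (AdjoinRoot.powerBasis' hm).dim = n := by simp
  let e : AdjoinRoot ((X : K[X]) ^ n) ≃ₗ[K] (K[X] ⧸ (K[X] ∙ (X : K[X]) ^ n)) :=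
    { AddEquiv.refl _ with map_smul' := fun _ _ => rfl }
  refine ⟨(b.reindex (finCongr hd)).map e, fun l => ?_⟩
  rw [Basis.map_apply, Basis.reindex_apply, PowerBasis.basis_eq_pow, AdjoinRoot.powerBasis'_gen]
  change e ((AdjoinRoot.mk _ X) ^ l.val) = _
  rw [← map_pow]
  rfl

/-- A nilpotent endomorphism has a Jordan basis, by the structure theorem for torsion modules over
`K[X]`. -/
theorem exists_isJordanBasis [FiniteDimensional K W] (N : Module.End K W) (hN : IsNilpotent N) :
    ∃ (d : ℕ) (s : Fin d → ℕ) (b : Basis (Σ i, Fin (s i)) K W), ∀ i (l : Fin (s i)),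
      N (b ⟨i, l⟩) = if h : l.val + 1 < s i then b ⟨i, ⟨l + 1, h⟩⟩ else 0 := by
  obtain ⟨n, hn⟩ := hN
  have htors : Module.IsTorsion' (AEval' N) (Submonoid.powers (X : K[X])) := by
    intro m
    refine ⟨⟨X ^ n, n, rfl⟩, ?_⟩
    obtain ⟨w, rfl⟩ := (AEval'.of N).surjective m
    rw [Submonoid.smul_def]
    rw [AEval'.X_pow_smul_of, hn, zero_smul, map_zero]
  have : Module.Finite K[X] (AEval' N) := inferInstance
  obtain ⟨d, s, ⟨e⟩⟩ := Module.torsion_by_prime_power_decomposition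
    (Polynomial.irreducible_X (R := K)) htors
  choose c hc using fun i => exists_quotient_X_pow_basis (K := K) (s i)
  let B := DFinsupp.basis c
  let e' : W ≃ₗ[K] Π₀ i : Fin d, (K[X] ⧸ (K[X] ∙ (X : K[X]) ^ s i)) :=
    (AEval'.of N).trans (e.restrictScalars K)
  refine ⟨d, s, B.map e'.symm, fun i l => ?_⟩
  have he' : ∀ w, e' (N w) = (X : K[X]) • e' w := by
    intro w
    change e (AEval'.of N (N w)) = (X : K[X]) • e (AEval'.of N w)
    rw [← map_smul, AEval'.X_smul_of]
  have hB : ∀ i l, B ⟨i, l⟩ = DFinsupp.single i (Submodule.Quotient.mk ((X : K[X]) ^ l.val)) := by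
    intro i l
    rw [← hc]
    simp [B, DFinsupp.basis]
  apply e'.injective
  rw [he', Basis.map_apply, LinearEquiv.apply_symm_apply, hB, ← DFinsupp.single_smul,
    ← Submodule.Quotient.mk_smul, smul_eq_mul, ← pow_succ']
  split_ifs with h
  · rw [Basis.map_apply, LinearEquiv.apply_symm_apply, hB]
  · have : l.val + 1 = s i := by omega
    rw [map_zero, this, (Submodule.Quotient.mk_eq_zero _).2 (Submodule.mem_span_singleton_self _),
      DFinsupp.single_zero]

theorem exists_hasJordanType [FiniteDimensional K W] (σ : TruncPoly K p →ₐ[K] Module.End K W) :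
    ∃ a, HasJordanType σ a := by
  classical
  let N := σ (TruncPoly.t K p)
  have hN : N ^ p = 0 := by rw [← map_pow, TruncPoly.t_pow_eq_zero, map_zero]
  obtain ⟨d, s, b, hb⟩ := exists_isJordanBasis N ⟨p, hN⟩
  have hs : ∀ i, s i ≤ p := by
    intro i
    by_contra! h
    have h1 := pow_apply_of_isJordanBasis hb p i ⟨0, by omega⟩
    rw [hN, dif_pos (by simpa using h)] at h1
    exact b.ne_zero _ h1.symm
  let ι (i : Fin p) := {m : Fin d // s m = i.val + 1}
  let a : JordanType p := fun i => Fintype.card (ι i)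
  let c (i : Fin p) : Fin (a i) ≃ ι i := (Fintype.equivFin (ι i)).symm
  let e : (Σ m, Fin (s m)) ≃ (Σ i : Fin p, Fin (a i) × Fin (i.val + 1)) :=
    { toFun := fun x =>
        ⟨⟨s x.1 - 1, by have := hs x.1; have := x.2.2; omega⟩,
          (c _).symm ⟨x.1, by have := x.2.2; simp only; omega⟩,
          ⟨x.2.val, by have := x.2.2; simp only; omega⟩⟩
      invFun := fun y => ⟨(c y.1 y.2.1).1, ⟨y.2.2.val, by rw [(c y.1 y.2.1).2]; exact y.2.2.2⟩⟩
      left_inv := by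
        rintro ⟨m, l⟩
        have key : ∀ (m' : Fin d) (h : m' = m) (h1 : l.val < s m'),
            (⟨m', ⟨l.val, h1⟩⟩ : Σ m, Fin (s m)) = ⟨m, l⟩ := by
          rintro m' rfl h1
          rfl
        apply key
        simp
      right_inv := by
        rintro ⟨i, x, l⟩
        have key : ∀ (i' : Fin p) (h : i' = i) (h1 : s (c i x).1 = i'.val + 1)
            (h2 : l.val < i'.val + 1),
            (⟨i', (c i').symm ⟨(c i x).1, h1⟩, ⟨l.val, h2⟩⟩ :
              Σ i : Fin p, Fin (a i) × Fin (i.val + 1)) = ⟨i, x, l⟩ := by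
          rintro i' rfl h1 h2
          simp
        apply key
        apply Fin.ext
        simp [(c i x).2] }
  refine ⟨a, b.reindex e, fun i x l => ?_⟩
  simp only [Basis.reindex_apply]
  change N (b ⟨(c i x).1, ⟨l.val, _⟩⟩) = _
  rw [hb]
  have h2 := (c i x).2
  by_cases h : l.val + 1 < i.val + 1
  · rw [dif_pos h, dif_pos (by simpa [h2] using h)]
    rfl
  · rw [dif_neg h, dif_neg (by simpa [h2] using h)]

/-- The ranks of the powers of `t` determine a finite dimensional `K[t]/t^p`-module. -/
theorem repIso_of_finrank_range_pow_eq [FiniteDimensional K W] [FiniteDimensional K W']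
    {σ : TruncPoly K p →ₐ[K] Module.End K W} {τ : TruncPoly K p →ₐ[K] Module.End K W'}
    (h : ∀ j, finrank K (LinearMap.range (σ (TruncPoly.t K p) ^ j)) =
      finrank K (LinearMap.range (τ (TruncPoly.t K p) ^ j))) : RepIso σ τ := by
  obtain ⟨a, ha⟩ := exists_hasJordanType σ
  obtain ⟨a', ha'⟩ := exists_hasJordanType τ
  obtain rfl : a = a' := JordanType.eq_of_tail_eq fun j => by
    rw [← ha.finrank_range_pow, ← ha'.finrank_range_pow, h]
  obtain ⟨b, hb⟩ := ha
  obtain ⟨b', hb'⟩ := ha'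
  let e := b.equiv b' (Equiv.refl _)
  have he : ∀ x, e (b x) = b' x := fun x => by simp [e]
  refine repIso_of_commutes e fun w => ?_
  have : e.toLinearMap ∘ₗ σ (TruncPoly.t K p) = τ (TruncPoly.t K p) ∘ₗ e.toLinearMap := by
    refine b.ext ?_
    rintro ⟨i, c, l⟩
    simp only [LinearMap.comp_apply, LinearEquiv.coe_coe, he, hb, hb']
    split_ifs
    · rw [he]
    · rw [map_zero]
  exact LinearMap.congr_fun this w

theorem mul_finrank_range_pow_le [FiniteDimensional K W] {N : Module.End K W} (hN : N ^ p = 0)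
    (j : ℕ) : p * finrank K (LinearMap.range (N ^ j)) ≤ (p - j) * finrank K W := by
  obtain ⟨a, ha⟩ := exists_hasJordanType (TruncPoly.lift N hN)
  have h0 := ha.finrank_range_pow 0
  have hj := ha.finrank_range_pow j
  rw [TruncPoly.lift_t] at h0 hj
  rw [pow_zero, Module.End.one_eq_id, LinearMap.range_id, finrank_top] at h0
  rw [h0, hj, JordanType.tail, JordanType.tail, Finset.mul_sum, Finset.mul_sum]
  refine Finset.sum_le_sum fun i _ => ?_
  rw [← mul_assoc, ← mul_assoc]
  refine Nat.mul_le_mul_right _ ?_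
  have hi := i.2
  rcases le_total j (i.val + 1) with h | h
  · obtain ⟨m, hm⟩ := Nat.exists_eq_add_of_le h
    obtain ⟨n, hn⟩ := Nat.exists_eq_add_of_le (show i.val + 1 ≤ p from hi)
    have h1 : i.val + 1 - j = m := by omega
    have h2 : p - j = m + n := by omega
    have h3 : p = j + m + n := by omega
    rw [Nat.sub_zero, h1, h2, hm]
    calc p * m = (j + m + n) * m := by rw [← h3]
      _ ≤ (m + n) * (j + m) := by nlinarith [Nat.zero_le (n * j)]
  · simp [Nat.sub_eq_zero_of_le h]

end JordanTypes

/-! ### Flat modules over `K[t]/t^p` -/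

section Flatness

variable {K : Type*} [Field K] {p : ℕ}

theorem TruncPoly.isLocalRing (hp : 0 < p) : IsLocalRing (TruncPoly K p) := by
  have : Nontrivial (TruncPoly K p) := by
    refine Ideal.Quotient.nontrivial_iff.2 fun h => ?_
    rw [Ideal.span_singleton_eq_top] at h
    exact Polynomial.not_isUnit_X (isUnit_pow_iff hp.ne' |>.1 h)
  refine IsLocalRing.of_isUnit_or_isUnit_one_sub_self fun x => ?_
  obtain ⟨q, rfl⟩ := Ideal.Quotient.mk_surjective x
  have hn : IsNilpotent (TruncPoly.t K p) := ⟨p, TruncPoly.t_pow_eq_zero⟩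
  have hq : (Ideal.Quotient.mk (Ideal.span {(X : K[X]) ^ p})) q =
      TruncPoly.t K p * Ideal.Quotient.mk _ q.divX + algebraMap K _ (q.coeff 0) := by
    conv_lhs => rw [← Polynomial.divX_mul_X_add q]
    rw [map_add, map_mul, mul_comm]
    rfl
  have hnil : IsNilpotent
      (TruncPoly.t K p * Ideal.Quotient.mk (Ideal.span {(X : K[X]) ^ p}) q.divX) :=
    (Commute.all _ _).isNilpotent_mul_right hn
  by_cases h : q.coeff 0 = 0
  · right
    rw [hq, h, map_zero, add_zero]
    exact hnil.isUnit_one_sub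
  · left
    rw [hq, add_comm]
    exact hnil.isUnit_add_left_of_commute ((isUnit_iff_ne_zero.2 h).map _) (Commute.all _ _)

instance : Module.Finite K (TruncPoly K p) :=
  Polynomial.Monic.finite_quotient (monic_X_pow p)

theorem TruncPoly.finrank : finrank K (TruncPoly K p) = p := by
  rw [finrank_quotient_span_eq_natDegree]
  simp

theorem TruncPoly.exists_eq_t_mul (hp : 0 < p) {r : TruncPoly K p}
    (hr : TruncPoly.t K p ^ (p - 1) * r = 0) : ∃ r', r = TruncPoly.t K p * r' := by
  obtain ⟨q, rfl⟩ := Ideal.Quotient.mk_surjective r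
  rw [TruncPoly.t, ← map_pow, ← map_mul, Ideal.Quotient.eq_zero_iff_mem,
    Ideal.mem_span_singleton] at hr
  obtain ⟨c, hc⟩ := hr
  refine ⟨Ideal.Quotient.mk _ c, ?_⟩
  rw [TruncPoly.t, ← map_mul]
  congr 1
  have h1 : (X : K[X]) ^ p = X ^ (p - 1) * X := by
    rw [← pow_succ]; congr 1; omega
  rw [h1, mul_assoc] at hc
  exact mul_left_cancel₀ (pow_ne_zero _ X_ne_zero) hc

/-- A finite dimensional module over `K[t]/t^p` is flat exactly when `t ^ (p - 1)` has the largest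
possible rank, that is, when all Jordan blocks have size `p`. -/
theorem flat_truncPoly_iff (hp : 0 < p) (W : Type*) [AddCommGroup W] [Module K W]
    [FiniteDimensional K W] [Module (TruncPoly K p) W] [IsScalarTower K (TruncPoly K p) W] :
    Module.Flat (TruncPoly K p) W ↔
      p * finrank K (LinearMap.range
        (Algebra.lsmul K K W (TruncPoly.t K p) ^ (p - 1))) = finrank K W := by
  obtain ⟨a, ha⟩ := exists_hasJordanType (Algebra.lsmul K K W : TruncPoly K p →ₐ[K] _)
  have h0 := ha.finrank_range_pow 0
  rw [pow_zero, Module.End.one_eq_id, LinearMap.range_id, finrank_top] at h0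
  let P : Fin p := ⟨p - 1, by omega⟩
  have htop : a.tail (p - 1) = a P := by
    have h : a P = ∑ i : Fin p, if i = P then a i else 0 := by simp
    rw [h, JordanType.tail]
    refine Finset.sum_congr rfl fun i _ => ?_
    have hi := i.2
    by_cases hiP : i = P
    · rw [if_pos hiP, hiP, show P.val + 1 - (p - 1) = 1 by simp [P], one_mul]
    · have : i.val ≠ p - 1 := fun h => hiP (Fin.ext h)
      rw [if_neg hiP, show i.val + 1 - (p - 1) = 0 by omega, zero_mul]
  rw [ha.finrank_range_pow, htop, h0]
  have hfin : Module.Finite (TruncPoly K p) W := Module.Finite.of_restrictScalars_finite K _ W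
  constructor
  · intro hflat
    have := TruncPoly.isLocalRing (K := K) hp
    have : Module.Free (TruncPoly K p) W := Module.free_of_flat_of_isLocalRing
    let b := Module.finBasis (TruncPoly K p) W
    -- the kernel of `t ^ (p - 1)` is the range of `t`
    have hker : LinearMap.ker (Algebra.lsmul K K W (TruncPoly.t K p) ^ (p - 1)) =
        LinearMap.range (Algebra.lsmul K K W (TruncPoly.t K p) ^ 1) := by
      ext w
      rw [← map_pow, pow_one, LinearMap.mem_ker, LinearMap.mem_range]
      simp only [Algebra.lsmul_coe]
      constructor
      · intro hw
        have h1 : ∀ i, ∃ r', b.repr w i = TruncPoly.t K p * r' := fun i => by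
          refine TruncPoly.exists_eq_t_mul hp ?_
          have := congrArg (fun v => b.repr v i) hw
          simpa using this
        choose r' hr' using h1
        refine ⟨∑ i, r' i • b i, ?_⟩
        rw [Finset.smul_sum]
        conv_rhs => rw [← b.sum_repr w]
        refine Finset.sum_congr rfl fun i _ => ?_
        rw [hr', mul_smul]
      · rintro ⟨v, rfl⟩
        rw [smul_smul, ← pow_succ, Nat.sub_add_cancel hp, TruncPoly.t_pow_eq_zero]
        exact zero_smul (TruncPoly K p) v
    have h2 := LinearMap.finrank_range_add_finrank_ker
      (Algebra.lsmul K K W (TruncPoly.t K p) ^ (p - 1))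
    rw [hker, ha.finrank_range_pow, ha.finrank_range_pow, htop, h0, add_comm] at h2
    -- comparing dimensions, the number of blocks equals the number of blocks of size `p`
    have h3 : a.tail 0 = a.tail 1 + ∑ i, a i := by
      rw [JordanType.tail, JordanType.tail, ← Finset.sum_add_distrib]
      refine Finset.sum_congr rfl fun i _ => ?_
      rw [Nat.sub_zero, Nat.add_sub_cancel]; ring
    have h4 : ∑ i, a i = a P := by omega
    have h5 : ∀ i, i ≠ P → a i = 0 := by
      intro i hi
      have := Finset.add_sum_erase Finset.univ a (Finset.mem_univ P)
      have h6 : ∑ x ∈ Finset.univ.erase P, a x = 0 := by omega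
      exact Finset.sum_eq_zero_iff.1 h6 i (Finset.mem_erase.2 ⟨hi, Finset.mem_univ i⟩)
    rw [JordanType.tail, Finset.sum_eq_single P (fun i _ hi => by rw [h5 i hi, mul_zero])
      (fun h => absurd (Finset.mem_univ P) h)]
    simp only [P]
    rw [Nat.sub_zero, Nat.sub_add_cancel hp]
  · intro h
    have h5 : ∀ i, i ≠ P → a i = 0 := by
      intro i hi
      have h6 := Finset.add_sum_erase Finset.univ (fun i : Fin p => (i.val + 1 - 0) * a i)
        (Finset.mem_univ P)
      have h7 : (P.val + 1 - 0) * a P = p * a P := by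
        simp only [P]
        rw [Nat.sub_zero, Nat.sub_add_cancel hp]
      rw [JordanType.tail] at h
      have h8 : ∑ x ∈ Finset.univ.erase P, (x.val + 1 - 0) * a x = 0 := by
        omega
      have h9 := Finset.sum_eq_zero_iff.1 h8 i (Finset.mem_erase.2 ⟨hi, Finset.mem_univ i⟩)
      simpa using h9
    obtain ⟨b, hb⟩ := ha
    let g : (Fin (a P) → TruncPoly K p) →ₗ[TruncPoly K p] W :=
      Fintype.linearCombination (TruncPoly K p) fun c => b ⟨P, c, ⟨0, by omega⟩⟩
    have hmem : ∀ (n : ℕ) (c : Fin (a P)) (hn : n < P.val + 1), b ⟨P, c, ⟨n, hn⟩⟩ ∈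
        LinearMap.range g := by
      intro n c
      induction n with
      | zero => exact fun _ => ⟨Pi.single c 1, by simp [g]⟩
      | succ n ih =>
        intro hn
        have h1 := hb P c ⟨n, by omega⟩
        rw [dif_pos hn] at h1
        rw [← h1]
        exact Submodule.smul_mem _ _ (ih (by omega))
    have hsurj : Function.Surjective (g.restrictScalars K) := by
      rw [← LinearMap.range_eq_top, eq_top_iff, ← b.span_eq, Submodule.span_le]
      rintro _ ⟨⟨i, c, l⟩, rfl⟩
      have hi : i = P := by
        by_contra hi
        exact absurd (h5 i hi) (Fin.pos c).ne'
      subst hi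
      exact hmem l.val c l.2
    have hinj : Function.Injective (g.restrictScalars K) := by
      refine (LinearMap.injective_iff_surjective_of_finrank_eq_finrank ?_).2 hsurj
      rw [Module.finrank_pi_fintype, h0, ← h]
      simp [TruncPoly.finrank, mul_comm]
    exact Module.Flat.of_linearEquiv (LinearEquiv.ofBijective g ⟨hinj, hsurj⟩).symm

theorem isLeftFlat_iff (hp : 0 < p) {H : Type*} [Ring H] [Algebra K H] [FiniteDimensional K H]
    (f : TruncPoly K p →ₐ[K] H) :
    IsLeftFlat f.toRingHom ↔
      p * finrank K (LinearMap.range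
        (Algebra.lmul K H (f (TruncPoly.t K p)) ^ (p - 1))) = finrank K H := by
  let _ : Module (TruncPoly K p) H := Module.compHom H f.toRingHom
  have hs : ∀ (r : TruncPoly K p) (h : H), r • h = f r * h := fun _ _ => rfl
  have : IsScalarTower K (TruncPoly K p) H := ⟨fun c r h => by
    rw [hs, hs, map_smul, smul_mul_assoc]⟩
  exact flat_truncPoly_iff hp H

end Flatness

/-! ### Ranks on representations, duals and field extensions -/

section Representations

variable {k : Type*} [Field k] {A : Type*} [CommRing A] [HopfAlgebra k A]

/-- The antipode of `kG` as a linear map `kG → kG`. -/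
def GroupAlg.anti (k : Type*) [Field k] (A : Type*) [CommRing A] [HopfAlgebra k A] :
    GroupAlg k A →ₗ[k] GroupAlg k A :=
  (MulOpposite.opLinearEquiv k).symm.toLinearMap ∘ₗ (GroupAlg.antipode k A).toLinearMap

theorem GroupAlg.unop_antipode (x : GroupAlg k A) :
    (GroupAlg.antipode k A x).unop = GroupAlg.anti k A x := rfl

theorem GroupAlg.anti_ofConv_apply (x : GroupAlg k A) (a : A) :
    (GroupAlg.anti k A x).ofConv a = x.ofConv (HopfAlgebra.antipode k a) := rfl

theorem GroupAlg.anti_pow (x : GroupAlg k A) (n : ℕ) :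
    GroupAlg.anti k A (x ^ n) = GroupAlg.anti k A x ^ n := by
  rw [← unop_antipode, map_pow, MulOpposite.unop_pow]
  rfl

/-- On a commutative Hopf algebra the antipode is an involution. -/
theorem antipode_antipode (a : A) :
    HopfAlgebra.antipode k (HopfAlgebra.antipode k a) = a := by
  have h := inv_inv (WithConv.toConv (AlgHom.id k A))
  have h2 := DFunLike.congr_fun (congrArg WithConv.ofConv h) a
  exact h2

theorem GroupAlg.anti_anti (x : GroupAlg k A) :
    GroupAlg.anti k A (GroupAlg.anti k A x) = x := by
  apply WithConv.ofConv_injective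
  ext a
  rw [anti_ofConv_apply, anti_ofConv_apply, antipode_antipode]

variable {V : Type*} [AddCommGroup V] [Module k V]

theorem finrank_range_dual_pow {ρ : GroupAlg k A →ₐ[k] Module.End k V} [FiniteDimensional k V]
    (x : GroupAlg k A) (j : ℕ) :
    finrank k (LinearMap.range (dual ρ x ^ j)) =
      finrank k (LinearMap.range (ρ (GroupAlg.anti k A x) ^ j)) := by
  rw [← map_pow, ← map_pow, ← GroupAlg.anti_pow]
  exact LinearMap.finrank_range_dualMap_eq_finrank_range _

variable (K : Type*) [Field K] [Algebra k K]

theorem GroupAlg.toBaseChange_apply_tmul (f : GroupAlg k A) (c : K) (a : A) :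
    (GroupAlg.toBaseChange k A K f).ofConv (c ⊗ₜ a) = f.ofConv a • c := rfl

theorem GroupAlg.anti_smul_toBaseChange (c : K) (f : GroupAlg k A) :
    GroupAlg.anti K (K ⊗[k] A) (c • GroupAlg.toBaseChange k A K f) =
      c • GroupAlg.toBaseChange k A K (GroupAlg.anti k A f) := by
  rw [map_smul]
  congr 1
  apply WithConv.ofConv_injective
  apply LinearMap.ext
  intro m
  induction m using TensorProduct.induction_on with
  | zero => simp
  | add a b ha hb => simp only [map_add, ha, hb]
  | tmul d a =>
    rw [anti_ofConv_apply, TensorProduct.antipode_def,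
      TensorProduct.AlgebraTensorModule.map_tmul, toBaseChange_apply_tmul, toBaseChange_apply_tmul,
      anti_ofConv_apply, CommSemiring.antipode_eq_id, LinearMap.id_apply]

variable [Module.Finite k A]

theorem GroupAlg.baseChangeEquiv_tmul (c : K) (f : GroupAlg k A) :
    GroupAlg.baseChangeEquiv k A K (c ⊗ₜ f) = c • GroupAlg.toBaseChange k A K f := by
  change GroupAlg.baseChangeHom k A K (c ⊗ₜ f) = _
  rw [baseChangeHom, Algebra.TensorProduct.lift_tmul, Algebra.smul_def]
  rfl

/-- The elements of `KG` are sums of multiples of elements of `kG`. -/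
theorem GroupAlg.baseChange_induction {P : GroupAlg K (K ⊗[k] A) → Prop}
    (h : ∀ (c : K) (f : GroupAlg k A), P (c • GroupAlg.toBaseChange k A K f))
    (hadd : ∀ x y, P x → P y → P (x + y)) (x : GroupAlg K (K ⊗[k] A)) : P x := by
  obtain ⟨m, rfl⟩ := (GroupAlg.baseChangeEquiv k A K).surjective x
  induction m using TensorProduct.induction_on with
  | zero => simpa using h 0 0
  | add a b ha hb => rw [map_add]; exact hadd _ _ ha hb
  | tmul c f => rw [baseChangeEquiv_tmul]; exact h c f

theorem baseChange_smul_toBaseChange_tmul (ρ : GroupAlg k A →ₐ[k] Module.End k V)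
    (c d : K) (f : GroupAlg k A) (v : V) :
    baseChange K ρ (c • GroupAlg.toBaseChange k A K f) (d ⊗ₜ v) = (c * d) ⊗ₜ ρ f v := by
  rw [← GroupAlg.baseChangeEquiv_tmul]
  simp only [baseChange, AlgHom.comp_apply]
  rw [show (GroupAlg.baseChangeEquiv k A K).symm.toAlgHom
    (GroupAlg.baseChangeEquiv k A K (c ⊗ₜ f)) = c ⊗ₜ f from AlgEquiv.symm_apply_apply _ _,
    Algebra.TensorProduct.lift_tmul, Algebra.ofId_apply,
    Module.End.mul_apply, Module.algebraMap_end_apply]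
  change c • (d ⊗ₜ ρ f v) = _
  rw [TensorProduct.smul_tmul', smul_eq_mul]

/-- Base change commutes with duals. -/
theorem repIso_baseChange_dual [FiniteDimensional k V] (ρ : GroupAlg k A →ₐ[k] Module.End k V) :
    RepIso (baseChange K (dual ρ)) (dual (baseChange K ρ)) := by
  let e := (TensorProduct.isBaseChange k V K).toDualBaseChange
  have he : ∀ (c d : K) (f : Module.Dual k V) (v : V),
      e (c ⊗ₜ f) (d ⊗ₜ v) = c * d * algebraMap k K (f v) := by
    intro c d f v
    have h := (TensorProduct.isBaseChange k V K).toDualBaseChange_tmul c f v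
    have h2 : (d ⊗ₜ v : K ⊗[k] V) = d • (1 ⊗ₜ v) := by simp [TensorProduct.smul_tmul']
    rw [h2, map_smul]
    change d • e (c ⊗ₜ f) (TensorProduct.mk k K V 1 v) = _
    rw [h, smul_eq_mul]
    ring
  refine ⟨e, fun x => ?_⟩
  induction x using GroupAlg.baseChange_induction with
  | hadd x y hx hy => intro v; simp only [map_add, LinearMap.add_apply, hx, hy]
  | h c g =>
    intro m
    induction m using TensorProduct.induction_on with
    | zero => simp
    | add a b ha hb => simp only [map_add, ha, hb]
    | tmul d f =>
      apply LinearMap.ext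
      intro w
      induction w using TensorProduct.induction_on with
      | zero => simp
      | add a b ha hb => simp only [map_add, ha, hb]
      | tmul d' v =>
        rw [baseChange_smul_toBaseChange_tmul, he]
        change _ = e (d ⊗ₜ f) (baseChange K ρ (GroupAlg.anti K (K ⊗[k] A) _) (d' ⊗ₜ v))
        rw [GroupAlg.anti_smul_toBaseChange, baseChange_smul_toBaseChange_tmul, he]
        change _ * algebraMap k K (f (ρ (GroupAlg.anti k A g) v)) = _
        ring

/-- The rank of the `j`-th power of `x ∈ KG` on `M_K`. -/
def rk (ρ : GroupAlg k A →ₐ[k] Module.End k V) {K : Type*} [Field K] [Algebra k K]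
    (x : GroupAlg K (K ⊗[k] A)) (j : ℕ) : ℕ :=
  finrank K (LinearMap.range (baseChange K ρ x ^ j))

theorem RepIso.finrank_range_pow_eq {K : Type*} [Field K] {H : Type*} [Ring H] [Algebra K H]
    {W : Type*} [AddCommGroup W] [Module K W] {W' : Type*} [AddCommGroup W'] [Module K W']
    {σ : H →ₐ[K] Module.End K W} {τ : H →ₐ[K] Module.End K W'} (h : RepIso σ τ) (x : H) (j : ℕ) :
    finrank K (LinearMap.range (σ x ^ j)) = finrank K (LinearMap.range (τ x ^ j)) := by
  obtain ⟨e, he⟩ := h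
  rw [← map_pow, ← map_pow]
  exact finrank_range_conj e _ _ (he _)

variable {K}

/-- The ranks of `x` on the dual module are those of `S(x)` on the module. -/
theorem rk_dual [FiniteDimensional k V] (ρ : GroupAlg k A →ₐ[k] Module.End k V)
    (x : GroupAlg K (K ⊗[k] A)) (j : ℕ) :
    rk (dual ρ) x j = rk ρ (GroupAlg.anti K (K ⊗[k] A) x) j := by
  rw [rk, (repIso_baseChange_dual K ρ).finrank_range_pow_eq, finrank_range_dual_pow, rk]

theorem finrank_range_neg_pow {K W : Type*} [Field K] [AddCommGroup W] [Module K W]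
    (N : Module.End K W) (j : ℕ) :
    finrank K (LinearMap.range ((-N) ^ j)) = finrank K (LinearMap.range (N ^ j)) := by
  rcases Nat.even_or_odd j with h | h
  · rw [h.neg_pow]
  · rw [h.neg_pow, LinearMap.range_neg]

theorem rk_neg (ρ : GroupAlg k A →ₐ[k] Module.End k V)
    (x : GroupAlg K (K ⊗[k] A)) (j : ℕ) : rk ρ (-x) j = rk ρ x j := by
  rw [rk, rk, map_neg]
  exact finrank_range_neg_pow _ j

/-- For the regular representation, `rk` computes the ranks of left multiplications on `KG`. -/
theorem rk_regular (x : GroupAlg K (K ⊗[k] A)) (j : ℕ) :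
    rk (Algebra.lmul k (GroupAlg k A)) x j =
      finrank K (LinearMap.range (Algebra.lmul K (GroupAlg K (K ⊗[k] A)) x ^ j)) := by
  refine RepIso.finrank_range_pow_eq ⟨(GroupAlg.baseChangeEquiv k A K).toLinearEquiv, ?_⟩ x j
  intro x v
  change GroupAlg.baseChangeEquiv k A K _ = x * GroupAlg.baseChangeEquiv k A K v
  induction x using GroupAlg.baseChange_induction with
  | hadd x y hx hy => simp only [map_add, LinearMap.add_apply, add_mul, hx, hy]
  | h c g =>
    induction v using TensorProduct.induction_on with
    | zero => simp
    | add a b ha hb => simp only [map_add, mul_add, ha, hb]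
    | tmul d f =>
      rw [baseChange_smul_toBaseChange_tmul, GroupAlg.baseChangeEquiv_tmul,
        GroupAlg.baseChangeEquiv_tmul, smul_mul_smul_comm, ← map_mul]
      rfl

end Representations

section Extension

variable {k : Type*} [Field k] {A : Type*} [CommRing A] [HopfAlgebra k A] [Module.Finite k A]
  (K : Type*) [Field K] [Algebra k K] (L : Type*) [Field L] [Algebra k L] [Algebra K L]
  [IsScalarTower k K L]

/-- The map `KG → LG` for a tower of field extensions `L/K/k`. -/
def GroupAlg.extend : GroupAlg K (K ⊗[k] A) →+* GroupAlg L (L ⊗[k] A) :=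
  ((GroupAlg.baseChangeEquiv k A L).toRingEquiv.toRingHom.comp
    (Algebra.TensorProduct.map (IsScalarTower.toAlgHom k K L)
      (AlgHom.id k (GroupAlg k A))).toRingHom).comp
    (GroupAlg.baseChangeEquiv k A K).symm.toRingEquiv.toRingHom

theorem GroupAlg.extend_smul_toBaseChange (c : K) (f : GroupAlg k A) :
    GroupAlg.extend K L (c • GroupAlg.toBaseChange k A K f) =
      algebraMap K L c • GroupAlg.toBaseChange k A L f := by
  rw [← baseChangeEquiv_tmul, ← baseChangeEquiv_tmul]
  simp [extend]

theorem GroupAlg.extend_apply_tmul (x : GroupAlg K (K ⊗[k] A)) (l : L) (a : A) :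
    (GroupAlg.extend K L x).ofConv (l ⊗ₜ a) = l * algebraMap K L (x.ofConv (1 ⊗ₜ a)) := by
  induction x using GroupAlg.baseChange_induction with
  | hadd x y hx hy =>
    simp only [map_add, WithConv.ofConv_add, LinearMap.add_apply, hx, hy, mul_add]
  | h c g =>
    rw [extend_smul_toBaseChange]
    change algebraMap K L c * (g.ofConv a • l) =
      l * algebraMap K L (c * (g.ofConv a • (1 : K)))
    rw [map_mul, Algebra.smul_def, Algebra.smul_def, mul_one, ← IsScalarTower.algebraMap_apply]
    ring

theorem GroupAlg.extend_anti (x : GroupAlg K (K ⊗[k] A)) :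
    GroupAlg.extend K L (GroupAlg.anti K (K ⊗[k] A) x) =
      GroupAlg.anti L (L ⊗[k] A) (GroupAlg.extend K L x) := by
  induction x using GroupAlg.baseChange_induction with
  | hadd x y hx hy => simp only [map_add, hx, hy]
  | h c g =>
    rw [anti_smul_toBaseChange, extend_smul_toBaseChange, extend_smul_toBaseChange,
      anti_smul_toBaseChange]

variable {V : Type*} [AddCommGroup V] [Module k V]

variable {K} in
/-- The canonical map `L ⊗ (K ⊗ V) ≃ L ⊗ V` is compatible with the actions of `KG` and `LG`. -/
theorem baseChange_extend_apply (ρ : GroupAlg k A →ₐ[k] Module.End k V)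
    (x : GroupAlg K (K ⊗[k] A)) (m : L ⊗[K] (K ⊗[k] V)) :
    TensorProduct.AlgebraTensorModule.cancelBaseChange k K L L V
      ((baseChange K ρ x).baseChange L m) =
      baseChange L ρ (GroupAlg.extend K L x)
        (TensorProduct.AlgebraTensorModule.cancelBaseChange k K L L V m) := by
  induction x using GroupAlg.baseChange_induction with
  | hadd x y hx hy =>
    simp only [map_add, LinearMap.baseChange_add, LinearMap.add_apply, hx, hy]
  | h c g =>
    induction m using TensorProduct.induction_on with
    | zero => simp
    | add a b ha hb => simp only [map_add, ha, hb]
    | tmul l m =>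
      induction m using TensorProduct.induction_on with
      | zero => simp
      | add a b ha hb => simp only [TensorProduct.tmul_add, map_add, ha, hb]
      | tmul d v =>
        rw [LinearMap.baseChange_tmul, baseChange_smul_toBaseChange_tmul,
          GroupAlg.extend_smul_toBaseChange]
        rw [TensorProduct.AlgebraTensorModule.cancelBaseChange_tmul,
          TensorProduct.AlgebraTensorModule.cancelBaseChange_tmul,
          baseChange_smul_toBaseChange_tmul, mul_smul, Algebra.smul_def]

variable {K} in
theorem rk_extend (ρ : GroupAlg k A →ₐ[k] Module.End k V) [FiniteDimensional k V]
    (x : GroupAlg K (K ⊗[k] A)) (j : ℕ) : rk ρ (GroupAlg.extend K L x) j = rk ρ x j := by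
  rw [rk, rk, ← map_pow, ← map_pow, ← map_pow,
    ← finrank_range_baseChange L (baseChange K ρ (x ^ j))]
  exact (finrank_range_conj _ _ _ (baseChange_extend_apply L ρ (x ^ j))).symm

end Extension

/-! ### Unipotent abelian group schemes -/

section Unipotent

variable {K : Type*} [Field K] {B : Type*} [CommRing B] [HopfAlgebra K B]

theorem augmentation_apply (x : GroupAlg K B) : augmentation K B x = x.ofConv 1 := rfl

theorem augmentation_one : augmentation K B 1 = 1 := by
  rw [augmentation_apply, LinearMap.convOne_def]
  simp

theorem augmentation_mul (x y : GroupAlg K B) :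
    augmentation K B (x * y) = augmentation K B x * augmentation K B y := by
  rw [augmentation_apply, LinearMap.convMul_def]
  simp [augmentation_apply, Algebra.TensorProduct.one_def]

/-- The augmentation of a group algebra as an algebra map. -/
def augmentationAlgHom (K : Type*) [Field K] (B : Type*) [CommRing B] [HopfAlgebra K B] :
    GroupAlg K B →ₐ[K] K :=
  AlgHom.ofLinearMap (augmentation K B) augmentation_one augmentation_mul

theorem augmentation_eq_zero_of_isNilpotent {x : GroupAlg K B} (hx : IsNilpotent x) :
    augmentation K B x = 0 :=
  (hx.map (augmentationAlgHom K B)).eq_zero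

instance [Module.Finite K B] : Module.Finite K (GroupAlg K B) :=
  Module.Finite.equiv (WithConv.linearEquiv K (B →ₗ[K] K)).symm

variable [Coalgebra.IsCocomm K B]

/-- The augmentation ideal of a unipotent abelian group scheme is nil: otherwise some residue field
of `KC` would be a representation on which the augmentation ideal acts by units. -/
theorem IsUnipotent.isNilpotent [Module.Finite K B] (h : IsUnipotent K B) {x : GroupAlg K B}
    (hx : augmentation K B x = 0) : IsNilpotent x := by
  rw [nilpotent_iff_mem_prime]
  intro J hJ
  -- a nonzero fixed vector of the field `KC ⧸ J` is a unit, so the augmentation ideal acts by zero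
  have hpos : 0 < finrank K (GroupAlg K B ⧸ J) := finrank_pos
  obtain ⟨n, hn⟩ := Nat.exists_eq_succ_of_ne_zero hpos.ne'
  let e : (GroupAlg K B ⧸ J) ≃ₗ[K] (Fin (n + 1) → K) :=
    LinearEquiv.ofFinrankEq _ _ (by rw [hn]; simp)
  let τ : GroupAlg K B →ₐ[K] Module.End K (Fin (n + 1) → K) :=
    (e.conjAlgEquiv K).toAlgHom.comp
      ((Algebra.lmul K (GroupAlg K B ⧸ J)).comp (Ideal.Quotient.mkₐ K J))
  obtain ⟨v, hv, hfix⟩ := h n τ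
  have h1 := hfix x
  rw [hx, zero_smul] at h1
  have h2 : e (Ideal.Quotient.mk J x * e.symm v) = 0 := h1
  rw [LinearEquiv.map_eq_zero_iff, mul_eq_zero, LinearEquiv.map_eq_zero_iff] at h2
  exact Ideal.Quotient.eq_zero_iff_mem.1 (h2.resolve_right hv)

/-- If the augmentation ideal is nil, then it is nilpotent, and any representation has a nonzero
vector killed by it, in the image of the last power of the ideal that acts nontrivially. -/
theorem isUnipotent_of_isNilpotent [Module.Finite K B]
    (h : ∀ x : GroupAlg K B, augmentation K B x = 0 → IsNilpotent x) : IsUnipotent K B := by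
  intro n τ
  let I : Ideal (GroupAlg K B) := RingHom.ker (augmentationAlgHom K B)
  have : IsNoetherianRing (GroupAlg K B) := IsNoetherianRing.of_finite K _
  have hI : ∃ m, ∀ y ∈ I ^ m, τ y = 0 := by
    obtain ⟨m, hm⟩ := IsNoetherianRing.isNilpotent_nilradical (GroupAlg K B)
    refine ⟨m, fun y hy => ?_⟩
    have hle : I ≤ nilradical (GroupAlg K B) := fun x hx => mem_nilradical.2 (h x hx)
    have := Ideal.pow_right_mono hle m hy
    rw [hm] at this
    rw [show y = 0 from this, map_zero]
  classical
  have hm := Nat.find_spec hI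
  have hm0 : Nat.find hI ≠ 0 := by
    intro h0
    have h1 := hm 1 (by rw [h0, pow_zero, Ideal.one_eq_top]; trivial)
    rw [map_one] at h1
    exact one_ne_zero h1
  have hmin := Nat.find_min hI (Nat.sub_one_lt hm0)
  push Not at hmin
  obtain ⟨y, hy, hτy⟩ := hmin
  obtain ⟨w, hw⟩ : ∃ w, τ y w ≠ 0 := by
    by_contra! hcon
    exact hτy (LinearMap.ext hcon)
  refine ⟨τ y w, hw, fun x => ?_⟩
  have hx : x - augmentation K B x • 1 ∈ I := by
    change augmentation K B (x - augmentation K B x • 1) = 0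
    rw [map_sub, map_smul, augmentation_one, smul_eq_mul, mul_one, sub_self]
  have h1 : τ ((x - augmentation K B x • 1) * y) = 0 := hm _ (by
    have := Ideal.mul_mem_mul hx hy
    rwa [← pow_succ', Nat.sub_add_cancel (Nat.pos_of_ne_zero hm0)] at this)
  rw [map_mul, map_sub, map_smul, map_one] at h1
  have h2 := LinearMap.congr_fun h1 w
  simpa [sub_eq_zero] using h2

end Unipotent

/-! ### Closed subgroup schemes and Hopf ideals -/

section HopfIdeals

variable {K : Type*} [Field K] {H H' : Type*} [CommRing H] [HopfAlgebra K H] [CommRing H']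
  [HopfAlgebra K H']

theorem injective_map_kerLift (φ : H →ₐ[K] H') :
    Function.Injective (TensorProduct.map
      (Ideal.kerLiftAlg φ).toLinearMap (Ideal.kerLiftAlg φ).toLinearMap) :=
  TensorProduct.map_injective_of_flat_flat _ _ (Ideal.kerLiftAlg_injective φ)
    (Ideal.kerLiftAlg_injective φ)

theorem map_kerLift_map_mk (φ : H →ₐ[K] H') (m : H ⊗[K] H) :
    TensorProduct.map (Ideal.kerLiftAlg φ).toLinearMap (Ideal.kerLiftAlg φ).toLinearMap
      (TensorProduct.map (Ideal.Quotient.mkₐ K (RingHom.ker φ)).toLinearMap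
        (Ideal.Quotient.mkₐ K (RingHom.ker φ)).toLinearMap m) =
      TensorProduct.map φ.toLinearMap φ.toLinearMap m := by
  rw [← LinearMap.comp_apply, ← TensorProduct.map_comp]
  rfl

/-- The kernel of a map of Hopf algebras is a Hopf ideal. -/
theorem isHopfIdeal_ker (φ : H →ₐc[K] H')
    (hφ : ∀ x, φ (HopfAlgebra.antipode K x) = HopfAlgebra.antipode K (φ x)) :
    (RingHom.ker (φ : H →ₐ[K] H')).IsHopfIdeal K where
  counit_eq_zero := fun x hx => by
    have h : φ x = 0 := hx
    rw [← CoalgHomClass.counit_comp_apply φ x, h, map_zero]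
  map_mkQ_comul_eq_zero := fun x hx => by
    have h : φ x = 0 := hx
    apply injective_map_kerLift (φ : H →ₐ[K] H')
    refine Eq.trans ?_ (map_zero _).symm
    refine (map_kerLift_map_mk (φ : H →ₐ[K] H') _).trans ?_
    refine (CoalgHomClass.map_comp_comul_apply φ x).trans ?_
    rw [h, map_zero]
  antipode_mem := fun x hx => by
    have h : φ x = 0 := hx
    change φ _ = 0
    rw [hφ, h, map_zero]

theorem isCocomm_quotient_ker [Coalgebra.IsCocomm K H'] (φ : H →ₐc[K] H')
    [(RingHom.ker (φ : H →ₐ[K] H')).IsHopfIdeal K] :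
    Coalgebra.IsCocomm K (H ⧸ RingHom.ker (φ : H →ₐ[K] H')) where
  comm_comp_comul := by
    apply LinearMap.ext
    intro x
    obtain ⟨x, rfl⟩ := Ideal.Quotient.mk_surjective x
    apply injective_map_kerLift (φ : H →ₐ[K] H')
    rw [LinearMap.comp_apply, Bialgebra.Quotient.comul_mk]
    rw [LinearEquiv.coe_coe, ← TensorProduct.map_comm, map_kerLift_map_mk]
    have h := CoalgHomClass.map_comp_comul_apply φ x
    refine Eq.trans ?_ (map_kerLift_map_mk _ _).symm
    rw [TensorProduct.map_comm]
    refine (congrArg (TensorProduct.comm K H' H') h).trans ?_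
    rw [Coalgebra.comm_comul]
    exact h.symm

/-- The group algebra of the closed subgroup scheme defined by `I` consists of the functionals on
the coordinate algebra that vanish on `I`. -/
theorem mem_range_map_mk {I : Ideal H} [I.IsHopfIdeal K] {x : GroupAlg K H} :
    (∃ y, GroupAlg.map (Bialgebra.Quotient.mkBialgHom (R := K) I) y = x) ↔
      ∀ a ∈ I, x.ofConv a = 0 := by
  constructor
  · rintro ⟨y, rfl⟩ a ha
    change y.ofConv (Ideal.Quotient.mk I a) = 0
    rw [Ideal.Quotient.eq_zero_iff_mem.2 ha, map_zero]
  · intro h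
    refine ⟨WithConv.toConv ((I.restrictScalars K).liftQ x.ofConv h), ?_⟩
    apply WithConv.ofConv_injective
    ext a
    rfl

theorem map_mk_injective (I : Ideal H) [I.IsHopfIdeal K] :
    Function.Injective (GroupAlg.map (Bialgebra.Quotient.mkBialgHom (R := K) I)) := by
  intro x y h
  apply WithConv.ofConv_injective
  apply LinearMap.ext
  intro a
  obtain ⟨a, rfl⟩ := Ideal.Quotient.mk_surjective a
  exact LinearMap.congr_fun (congrArg WithConv.ofConv h) a

theorem map_mk_anti (I : Ideal H) [I.IsHopfIdeal K] (x : GroupAlg K (H ⧸ I)) :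
    GroupAlg.map (Bialgebra.Quotient.mkBialgHom (R := K) I) (GroupAlg.anti K (H ⧸ I) x) =
      GroupAlg.anti K H (GroupAlg.map (Bialgebra.Quotient.mkBialgHom (R := K) I) x) := by
  apply WithConv.ofConv_injective
  ext a
  rfl

end HopfIdeals

/-! ### Field extension of closed subgroup schemes -/

section SubgroupBaseChange

variable {K : Type*} [Field K] {B : Type*} [CommRing B] [HopfAlgebra K B]
  (L : Type*) [Field L] [Algebra K L]

/-- The augmentation ideal of a commutative group algebra stays nil under field extension. -/
theorem isNilpotent_baseChange [Coalgebra.IsCocomm K B] [Module.Finite K B]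
    (h : ∀ x : GroupAlg K B, augmentation K B x = 0 → IsNilpotent x) (x : GroupAlg L (L ⊗[K] B))
    (hx : augmentation L (L ⊗[K] B) x = 0) : IsNilpotent x := by
  suffices H : IsNilpotent (x - augmentation L (L ⊗[K] B) x • 1) by
    rwa [hx, zero_smul, sub_zero] at H
  clear hx
  induction x using GroupAlg.baseChange_induction with
  | hadd x y hx hy =>
    have := (Commute.all _ _).isNilpotent_add hx hy
    rw [map_add, add_smul]
    rwa [sub_add_sub_comm] at this
  | h c f =>
    have h1 : IsNilpotent (f - augmentation K B f • 1) := h _ (by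
      rw [map_sub, map_smul, augmentation_one, smul_eq_mul, mul_one, sub_self])
    have h2 := (h1.map (GroupAlg.toBaseChange K B L)).smul c
    convert! h2 using 1
    have h3 : augmentation L (L ⊗[K] B) (GroupAlg.toBaseChange K B L f) =
        algebraMap K L (augmentation K B f) := by
      rw [augmentation_apply, augmentation_apply, Algebra.TensorProduct.one_def,
        GroupAlg.toBaseChange_apply_tmul, Algebra.smul_def, mul_one]
    rw [map_sub, smul_sub, map_smul, map_smul, map_one, h3, smul_eq_mul, mul_smul,
      algebraMap_smul]

end SubgroupBaseChange

section SubgroupExtension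

variable {k : Type*} [Field k] {A : Type*} [CommRing A] [HopfAlgebra k A]
  {K : Type*} [Field K] [Algebra k K] (L : Type*) [Field L] [Algebra k L] [Algebra K L]
  [IsScalarTower k K L] {B : Type*} [CommRing B] [HopfAlgebra K B] (q : K ⊗[k] A →ₐc[K] B)

/-- The base change `L[G_L] → L ⊗ K[C]` of a map of Hopf algebras `K[G_K] → K[C]`, as an algebra
map. -/
def extendAlgHom : L ⊗[k] A →ₐ[L] L ⊗[K] B :=
  (Algebra.TensorProduct.map (AlgHom.id L L) (q : K ⊗[k] A →ₐ[K] B)).comp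
    (Algebra.TensorProduct.cancelBaseChange k K L L A).symm.toAlgHom

theorem extendAlgHom_tmul (l : L) (a : A) :
    extendAlgHom L q (l ⊗ₜ a) = l ⊗ₜ q (1 ⊗ₜ a) := by
  rw [extendAlgHom, AlgHom.comp_apply]
  have : (Algebra.TensorProduct.cancelBaseChange k K L L A).symm.toAlgHom (l ⊗ₜ a) =
      l ⊗ₜ (1 ⊗ₜ a) := Algebra.TensorProduct.cancelBaseChange_symm_tmul k K L L A l a
  rw [this, Algebra.TensorProduct.map_tmul]
  rfl

theorem counit_extendAlgHom :
    (Bialgebra.counitAlgHom L (L ⊗[K] B)).comp (extendAlgHom L q) =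
      Bialgebra.counitAlgHom L (L ⊗[k] A) := by
  ext a
  simp [extendAlgHom_tmul, Algebra.smul_def, ← IsScalarTower.algebraMap_apply]

theorem comul_extendAlgHom :
    (Algebra.TensorProduct.map (extendAlgHom L q) (extendAlgHom L q)).comp
      (Bialgebra.comulAlgHom L (L ⊗[k] A)) =
      (Bialgebra.comulAlgHom L (L ⊗[K] B)).comp (extendAlgHom L q) := by
  ext a
  have hq : Coalgebra.comul (R := K) (q (1 ⊗ₜ a)) =
      TensorProduct.map (q : K ⊗[k] A →ₗ[K] B) (q : K ⊗[k] A →ₗ[K] B)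
        (Coalgebra.comul ((1 : K) ⊗ₜ[k] a)) :=
    (CoalgHomClass.map_comp_comul_apply q (1 ⊗ₜ a)).symm
  simp only [AlgHom.coe_comp, AlgHom.coe_restrictScalars', Function.comp_apply,
    Algebra.TensorProduct.includeRight_apply, Bialgebra.comulAlgHom_apply, extendAlgHom_tmul,
    TensorProduct.comul_tmul, hq, CommSemiring.comul_apply]
  induction (Coalgebra.comul (R := k) a) using TensorProduct.induction_on with
  | zero => simp
  | add x y hx hy => simp only [map_add, TensorProduct.tmul_add, hx, hy]
  | tmul x y => simp [extendAlgHom_tmul]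

/-- `extendAlgHom` as a map of bialgebras. -/
def extendBialgHom : L ⊗[k] A →ₐc[L] L ⊗[K] B :=
  .ofAlgHom (extendAlgHom L q) (counit_extendAlgHom L q) (comul_extendAlgHom L q)

theorem extendBialgHom_tmul (l : L) (a : A) :
    extendBialgHom L q (l ⊗ₜ a) = l ⊗ₜ q (1 ⊗ₜ a) :=
  extendAlgHom_tmul L q l a

theorem extendBialgHom_antipode
    (hq : ∀ x, q (HopfAlgebra.antipode K x) = HopfAlgebra.antipode K (q x)) (x : L ⊗[k] A) :
    extendBialgHom L q (HopfAlgebra.antipode L x) =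
      HopfAlgebra.antipode L (extendBialgHom L q x) := by
  induction x using TensorProduct.induction_on with
  | zero => simp
  | add x y hx hy => simp only [map_add, hx, hy]
  | tmul l a =>
    rw [extendBialgHom_tmul]
    simp [extendBialgHom_tmul, ← hq]

/-- Closed unipotent abelian subgroup schemes are preserved by field extension. -/
theorem exists_subgroup_baseChange [Module.Finite k A] [Module.Finite K B]
    [Coalgebra.IsCocomm K B] (hq : ∀ x, q (HopfAlgebra.antipode K x) = HopfAlgebra.antipode K (q x))
    (hB : IsUnipotent K B) :
    ∃ (J : Ideal (L ⊗[k] A)) (_ : J.IsHopfIdeal L), Coalgebra.IsCocomm L ((L ⊗[k] A) ⧸ J) ∧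
      IsUnipotent L ((L ⊗[k] A) ⧸ J) ∧ ∀ y : GroupAlg K B,
        ∀ a ∈ J, (GroupAlg.extend K L (GroupAlg.map q y)).ofConv a = 0 := by
  let φ := extendBialgHom L q
  let J : Ideal (L ⊗[k] A) := RingHom.ker (φ : L ⊗[k] A →ₐ[L] L ⊗[K] B)
  have hJ : J.IsHopfIdeal L := isHopfIdeal_ker φ (extendBialgHom_antipode L q hq)
  have hc : Coalgebra.IsCocomm L ((L ⊗[k] A) ⧸ J) := isCocomm_quotient_ker φ
  have hfac : ∀ x : GroupAlg L (L ⊗[k] A), (∀ a ∈ J, x.ofConv a = 0) →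
      ∃ f, GroupAlg.map φ f = x := by
    intro x hx
    let g : ((L ⊗[k] A) ⧸ J) →ₗ[L] L ⊗[K] B :=
      (Ideal.kerLiftAlg (φ : L ⊗[k] A →ₐ[L] L ⊗[K] B)).toLinearMap
    obtain ⟨r, hr⟩ := g.exists_leftInverse_of_injective
      (LinearMap.ker_eq_bot.2 (Ideal.kerLiftAlg_injective _))
    obtain ⟨y, rfl⟩ := mem_range_map_mk.2 hx
    refine ⟨WithConv.toConv (y.ofConv ∘ₗ r), ?_⟩
    apply WithConv.ofConv_injective
    apply LinearMap.ext
    intro a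
    exact congrArg y.ofConv (LinearMap.congr_fun hr (Ideal.Quotient.mk J a))
  refine ⟨J, hJ, hc, ?_, ?_⟩
  · apply isUnipotent_of_isNilpotent
    intro y hy
    obtain ⟨f, hf⟩ := hfac _ (mem_range_map_mk.1 ⟨y, rfl⟩)
    have hf1 : augmentation L _ f = 0 := by
      have h1 := LinearMap.congr_fun (congrArg WithConv.ofConv hf) 1
      have h2 : f.ofConv (φ 1) = y.ofConv 1 := h1
      rw [map_one] at h2
      exact h2.trans hy
    obtain ⟨n, hn⟩ := isNilpotent_baseChange L (fun x hx => hB.isNilpotent hx) f hf1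
    refine ⟨n, map_mk_injective J ?_⟩
    rw [map_pow, ← hf, ← map_pow, hn, map_zero, map_zero]
  · intro y a ha
    -- the extended functional is `L ⊗ y` composed with the restriction map
    have h : ∀ a, (GroupAlg.extend K L (GroupAlg.map q y)).ofConv a =
        (Module.Dual.baseChange L y.ofConv) (φ a) := by
      intro a
      induction a using TensorProduct.induction_on with
      | zero => simp
      | add u v hu hv => simp only [map_add, hu, hv]
      | tmul l a =>
        rw [GroupAlg.extend_apply_tmul]
        change _ = Module.Dual.baseChange L y.ofConv (extendBialgHom L q _)
        rw [extendBialgHom_tmul, Module.Dual.baseChange_apply_tmul, Algebra.smul_def, mul_comm]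
        rfl
    have ha' : φ a = 0 := ha
    rw [h, ha', map_zero]

end SubgroupExtension

/-! ### Tensors with vanishing `p`-th power -/

section NilpotentTensors

variable {K : Type*} [Field K] {E : Type*} [CommRing E] [Algebra K E] {p : ℕ}

/-- The sums of elements `n ⊗ a` and `a ⊗ n` of `E ⊗ E` with `a ∈ I` and `n ^ p = 0`. -/
def nilTensors (I : Submodule K E) (p : ℕ) : AddSubmonoid (E ⊗[K] E) :=
  AddSubmonoid.closure {T | ∃ n a, n ^ p = 0 ∧ a ∈ I ∧ (T = n ⊗ₜ a ∨ T = a ⊗ₜ n)}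

theorem tmul_mem_nilTensors_left {I : Submodule K E} {n a : E} (hn : n ^ p = 0) (ha : a ∈ I) :
    n ⊗ₜ[K] a ∈ nilTensors I p :=
  AddSubmonoid.subset_closure ⟨n, a, hn, ha, Or.inl rfl⟩

theorem tmul_mem_nilTensors_right {I : Submodule K E} {n a : E} (hn : n ^ p = 0) (ha : a ∈ I) :
    a ⊗ₜ[K] n ∈ nilTensors I p :=
  AddSubmonoid.subset_closure ⟨n, a, hn, ha, Or.inr rfl⟩

theorem exists_nilTensors_add_sum {ι : Type*} [Fintype ι] {I : Submodule K E} {u : ι → E}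
    (hu : ∀ i, u i ∈ I) (hrep : ∀ a ∈ I, ∃ n : E, n ^ p = 0 ∧ ∃ c : ι → K, a = n + ∑ i, c i • u i)
    (T : I ⊗[K] I) : ∃ D ∈ nilTensors I p, ∃ c : ι × ι → K,
      TensorProduct.map I.subtype I.subtype T = D + ∑ ij, c ij • (u ij.1 ⊗ₜ[K] u ij.2) := by
  induction T using TensorProduct.induction_on with
  | zero => exact ⟨0, zero_mem _, 0, by simp⟩
  | add S T hS hT =>
    obtain ⟨D, hD, c, h⟩ := hS
    obtain ⟨D', hD', c', h'⟩ := hT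
    refine ⟨D + D', add_mem hD hD', c + c', ?_⟩
    simp only [map_add, h, h', Pi.add_apply, add_smul, Finset.sum_add_distrib]
    abel
  | tmul x y =>
    obtain ⟨n, hn, c, hc⟩ := hrep x x.2
    obtain ⟨n', hn', c', hc'⟩ := hrep y y.2
    have hUI : ∑ i, c i • u i ∈ I := Submodule.sum_mem _ fun i _ => Submodule.smul_mem _ _ (hu i)
    refine ⟨n ⊗ₜ (y : E) + (∑ i, c i • u i) ⊗ₜ n', add_mem (tmul_mem_nilTensors_left hn y.2)
      (tmul_mem_nilTensors_right hn' hUI), fun ij => c ij.1 * c' ij.2, ?_⟩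
    have h1 : ∑ ij : ι × ι, (c ij.1 * c' ij.2) • (u ij.1 ⊗ₜ[K] u ij.2) =
        (∑ i, c i • u i) ⊗ₜ (∑ i, c' i • u i) := by
      rw [Fintype.sum_prod_type, TensorProduct.sum_tmul]
      refine Finset.sum_congr rfl fun i _ => ?_
      rw [TensorProduct.tmul_sum]
      refine Finset.sum_congr rfl fun j _ => ?_
      rw [TensorProduct.smul_tmul_smul]
    rw [h1, TensorProduct.map_tmul, Submodule.subtype_apply, Submodule.subtype_apply, add_assoc,
      ← TensorProduct.tmul_add, ← hc']
    conv_lhs => rw [hc]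
    rw [TensorProduct.add_tmul]

variable [Fact p.Prime]

theorem pow_eq_zero_of_mem_nilTensors [CharP (E ⊗[K] E) p] {I : Submodule K E} {D : E ⊗[K] E}
    (hD : D ∈ nilTensors I p) : D ^ p = 0 := by
  refine AddSubmonoid.closure_induction (motive := fun D _ => D ^ p = 0) ?_
    (zero_pow (Fact.out : p.Prime).ne_zero) (fun a b _ _ ha hb => ?_) hD
  · rintro _ ⟨n, a, hn, -, rfl | rfl⟩
    · rw [Algebra.TensorProduct.tmul_pow, hn, TensorProduct.zero_tmul]
    · rw [Algebra.TensorProduct.tmul_pow, hn, TensorProduct.tmul_zero]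
  · rw [add_pow_char, ha, hb, add_zero]

/-- The subspace of elements of vanishing `p`-th power of a commutative algebra of
characteristic `p`. -/
def pNil (K : Type*) [Field K] (E : Type*) [CommRing E] [Algebra K E] (p : ℕ)
    [Fact p.Prime] [CharP E p] : Submodule K E where
  carrier := {y | y ^ p = 0}
  zero_mem' := zero_pow (Fact.out : p.Prime).ne_zero
  add_mem' := fun {a b} ha hb => by
    change (a + b) ^ p = 0
    rw [add_pow_char, show a ^ p = 0 from ha, show b ^ p = 0 from hb, add_zero]
  smul_mem' := fun c a ha => by
    change (c • a) ^ p = 0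
    rw [_root_.smul_pow, show a ^ p = 0 from ha, smul_zero]

variable [CharP E p]

theorem mem_pNil {y : E} : y ∈ pNil K E p ↔ y ^ p = 0 := Iff.rfl

variable [CharP K p]

/-- Over a perfect field the `p`-th powers of linearly independent elements stay independent, once
the span of these elements meets the elements of vanishing `p`-th power trivially. -/
theorem linearIndependent_pow_char [PerfectRing K p] {ι : Type*} {u : ι → E}
    (hu : LinearIndependent K u)
    (hd : Disjoint (Submodule.span K (Set.range u)) (pNil K E p)) :
    LinearIndependent K fun i => u i ^ p := by
  rw [linearIndependent_iff'] at hu ⊢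
  intro s c hc i hi
  have hroot : ∀ i, (frobeniusEquiv K p).symm (c i) ^ p = c i := fun i => by simp
  have h0 : ∑ i ∈ s, (frobeniusEquiv K p).symm (c i) • u i ∈ pNil K E p := by
    rw [mem_pNil, sum_pow_char]
    simpa only [_root_.smul_pow, hroot] using hc
  have h1 : ∑ i ∈ s, (frobeniusEquiv K p).symm (c i) • u i = 0 :=
    Submodule.disjoint_def.1 hd _ (Submodule.sum_mem _ fun i _ =>
      Submodule.smul_mem _ _ (Submodule.subset_span ⟨i, rfl⟩)) h0
  have h2 := hu s _ h1 i hi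
  rw [← hroot i, h2, zero_pow (Fact.out : p.Prime).ne_zero]

/-- Over a perfect field, the elements of `I ⊗ I` with vanishing `p`-th power are sums of
elements `n ⊗ a` and `a ⊗ n` with `n ^ p = 0`. -/
theorem mem_nilTensors_of_pow_eq_zero [PerfectRing K p] [FiniteDimensional K E]
    [CharP (E ⊗[K] E) p] {I : Submodule K E} (hI : pNil K E p ≤ I) (T : I ⊗[K] I)
    (hT : TensorProduct.map I.subtype I.subtype T ^ p = 0) :
    TensorProduct.map I.subtype I.subtype T ∈ nilTensors I p := by
  obtain ⟨U₀, hU₀⟩ := Submodule.exists_isCompl (pNil K E p)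
  let U := U₀ ⊓ I
  have hUd : Disjoint U (pNil K E p) := hU₀.disjoint.symm.mono_left inf_le_left
  have hsup : pNil K E p ⊔ U = I := by
    rw [← sup_inf_assoc_of_le _ hI, hU₀.sup_eq_top, top_inf_eq]
  let b := Module.finBasis K U
  let u : Fin (finrank K U) → E := fun i => (b i : E)
  have hspan : Submodule.span K (Set.range u) = U := by
    have h1 := congrArg (Submodule.map U.subtype) b.span_eq
    rw [Submodule.map_span, Submodule.map_top, Submodule.range_subtype, ← Set.range_comp] at h1
    exact h1
  have hu : LinearIndependent K u := b.linearIndependent.map' U.subtype (Submodule.ker_subtype _)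
  have hup := linearIndependent_pow_char (p := p) hu (by rwa [hspan])
  have hpp := hup.tmul_of_isDomain hup
  have hrep : ∀ a ∈ I, ∃ n : E, n ^ p = 0 ∧
      ∃ c : Fin (finrank K U) → K, a = n + ∑ i, c i • u i := by
    intro a ha
    rw [← hsup] at ha
    obtain ⟨n, hn, w, hw, rfl⟩ := Submodule.mem_sup.1 ha
    refine ⟨n, hn, b.repr ⟨w, hw⟩, ?_⟩
    congr 1
    have := congrArg U.subtype (b.sum_repr ⟨w, hw⟩)
    rw [map_sum] at this
    exact this.symm
  have huI : ∀ i, u i ∈ I := fun i => (inf_le_right : U₀ ⊓ I ≤ I) (b i).2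
  obtain ⟨D, hD, c, hc⟩ := exists_nilTensors_add_sum huI hrep T
  rw [hc, add_pow_char, pow_eq_zero_of_mem_nilTensors hD, zero_add, sum_pow_char] at hT
  simp only [_root_.smul_pow, Algebra.TensorProduct.tmul_pow] at hT
  have hc0 : ∀ ij, c ij = 0 := fun ij =>
    pow_eq_zero_iff (Fact.out : p.Prime).ne_zero |>.1
      (Fintype.linearIndependent_iff.1 hpp (fun ij => c ij ^ p) hT ij)
  rw [hc, Finset.sum_eq_zero fun ij _ => by rw [hc0, zero_smul], add_zero]
  exact hD

end NilpotentTensors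

/-! ### The group algebra of `C × C` -/

section DualTensor

variable {K : Type*} [Field K] {B : Type*} [CommRing B] [HopfAlgebra K B] [Module.Finite K B]

/-- The identification of `KC ⊗ KC` with the group algebra of `C × C`, as a linear map. -/
def prodGroupAlg (K : Type*) [Field K] (B : Type*) [CommRing B] [HopfAlgebra K B]
    [Module.Finite K B] : GroupAlg K B ⊗[K] GroupAlg K B ≃ₗ[K] GroupAlg K (B ⊗[K] B) :=
  TensorProduct.congr (WithConv.linearEquiv K (B →ₗ[K] K)) (WithConv.linearEquiv K (B →ₗ[K] K)) ≪≫ₗ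
    TensorProduct.dualDistribEquiv K B B ≪≫ₗ (WithConv.linearEquiv K (B ⊗[K] B →ₗ[K] K)).symm

theorem prodGroupAlg_tmul_apply (f g : GroupAlg K B) (a b : B) :
    (prodGroupAlg K B (f ⊗ₜ g)).ofConv (a ⊗ₜ b) = f.ofConv a * g.ofConv b := by
  simp [prodGroupAlg]

theorem prodGroupAlg_tmul_mul_tmul (f f' g g' : GroupAlg K B) :
    prodGroupAlg K B ((f * f') ⊗ₜ (g * g')) =
      prodGroupAlg K B (f ⊗ₜ g) * prodGroupAlg K B (f' ⊗ₜ g') := by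
  apply WithConv.ofConv_injective
  apply TensorProduct.ext'
  intro a b
  rw [prodGroupAlg_tmul_apply, LinearMap.convMul_def, LinearMap.convMul_def, LinearMap.convMul_def]
  simp only [LinearMap.comp_apply, TensorProduct.comul_tmul]
  induction (Coalgebra.comul (R := K) a) using TensorProduct.induction_on with
  | zero => simp
  | add x y hx hy => simp only [map_add, TensorProduct.add_tmul, add_mul, hx, hy]
  | tmul a a' =>
    induction (Coalgebra.comul (R := K) b) using TensorProduct.induction_on with
    | zero => simp
    | add x y hx hy => simp only [map_add, TensorProduct.tmul_add, mul_add, hx, hy]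
    | tmul b b' =>
      simp [prodGroupAlg_tmul_apply]
      ring

theorem prodGroupAlg_one : prodGroupAlg K B (1 ⊗ₜ 1) = 1 := by
  apply WithConv.ofConv_injective
  apply TensorProduct.ext'
  intro a b
  rw [prodGroupAlg_tmul_apply]
  simp [LinearMap.convOne_def, mul_comm]

/-- The identification of `KC ⊗ KC` with the group algebra of `C × C`. -/
def prodGroupAlgEquiv (K : Type*) [Field K] (B : Type*) [CommRing B] [HopfAlgebra K B]
    [Module.Finite K B] : GroupAlg K B ⊗[K] GroupAlg K B ≃ₐ[K] GroupAlg K (B ⊗[K] B) :=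
  Algebra.TensorProduct.algEquivOfLinearEquivTensorProduct (prodGroupAlg K B)
    prodGroupAlg_tmul_mul_tmul prodGroupAlg_one

end DualTensor

theorem sub_sub_pow_char_eq_zero {R : Type*} [CommRing R] {p : ℕ} [Fact p.Prime] [CharP R p]
    {a b c : R} (ha : a ^ p = 0) (hb : b ^ p = 0) (hc : c ^ p = 0) : (a - b - c) ^ p = 0 := by
  rw [sub_pow_char, sub_pow_char, ha, hb, hc, sub_zero, sub_zero]

/-- If `T ^ p = 0` and `x ^ p = 0`, then also `T - x ⊗ 1 - 1 ⊗ x` has vanishing `p`-th power. -/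
theorem mem_nilTensors_of_eq_sub_tmul_sub_tmul {K E : Type*} [Field K] [CommRing E] [Nontrivial E]
    [Algebra K E] [FiniteDimensional K E] {p : ℕ} [Fact p.Prime] [CharP K p] [PerfectRing K p]
    {I : Submodule K E} (hI : ∀ y : E, y ^ p = 0 → y ∈ I) {D : I ⊗[K] I} {T : E ⊗[K] E} {x : E}
    (hD : TensorProduct.map I.subtype I.subtype D = T - x ⊗ₜ 1 - 1 ⊗ₜ x) (hT : T ^ p = 0)
    (hx : x ^ p = 0) : T - x ⊗ₜ 1 - 1 ⊗ₜ x ∈ nilTensors I p := by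
  have : CharP E p := charP_of_injective_algebraMap (algebraMap K E).injective p
  have : CharP (E ⊗[K] E) p :=
    charP_of_injective_algebraMap (algebraMap K (E ⊗[K] E)).injective p
  rw [← hD]
  refine mem_nilTensors_of_pow_eq_zero hI D ?_
  rw [hD]
  refine sub_sub_pow_char_eq_zero hT ?_ ?_
  · rw [Algebra.TensorProduct.tmul_pow, hx, TensorProduct.zero_tmul]
  · rw [Algebra.TensorProduct.tmul_pow, hx, TensorProduct.tmul_zero]

/-! ### The antipode on `p`-nilpotent elements -/

section Antipode

variable {K : Type*} [Field K] {B : Type*} [CommRing B] [HopfAlgebra K B]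

/-- The projection `f ↦ f - ε(f)` of a group algebra onto its augmentation ideal. -/
def augProj (K : Type*) [Field K] (B : Type*) [CommRing B] [HopfAlgebra K B] :
    GroupAlg K B →ₗ[K] LinearMap.ker (augmentation K B) :=
  LinearMap.codRestrict _ (LinearMap.id - (augmentation K B).smulRight 1) fun f => by
    simp [augmentation_one]

theorem augProj_coe (f : GroupAlg K B) :
    (augProj K B f : GroupAlg K B) = f - augmentation K B f • 1 := rfl

/-- The map `f ⊗ g ↦ ε(g) f`. -/
def augRight (K : Type*) [Field K] (B : Type*) [CommRing B] [HopfAlgebra K B] :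
    GroupAlg K B ⊗[K] GroupAlg K B →ₗ[K] GroupAlg K B :=
  TensorProduct.lift ((LinearMap.lsmul K (GroupAlg K B) ∘ₗ augmentation K B).flip)

/-- The map `f ⊗ g ↦ ε(f) g`. -/
def augLeft (K : Type*) [Field K] (B : Type*) [CommRing B] [HopfAlgebra K B] :
    GroupAlg K B ⊗[K] GroupAlg K B →ₗ[K] GroupAlg K B :=
  TensorProduct.lift (LinearMap.lsmul K (GroupAlg K B) ∘ₗ augmentation K B)

/-- The map `f ⊗ g ↦ f S(g)`. -/
def mulAnti (K : Type*) [Field K] (B : Type*) [CommRing B] [HopfAlgebra K B] :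
    GroupAlg K B ⊗[K] GroupAlg K B →ₗ[K] GroupAlg K B :=
  TensorProduct.lift ((LinearMap.mul K (GroupAlg K B)).compl₂ (GroupAlg.anti K B))

theorem augRight_tmul (f g : GroupAlg K B) :
    augRight K B (f ⊗ₜ g) = augmentation K B g • f := rfl

theorem augLeft_tmul (f g : GroupAlg K B) :
    augLeft K B (f ⊗ₜ g) = augmentation K B f • g := rfl

theorem mulAnti_tmul (f g : GroupAlg K B) :
    mulAnti K B (f ⊗ₜ g) = f * GroupAlg.anti K B g := rfl

/-- For `T ∈ KC ⊗ KC`, the component of `T` in the tensor square of the augmentation ideal. -/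
theorem map_augProj (T : GroupAlg K B ⊗[K] GroupAlg K B) :
    TensorProduct.map (LinearMap.ker (augmentation K B)).subtype
      (LinearMap.ker (augmentation K B)).subtype
      (TensorProduct.map (augProj K B) (augProj K B) T) =
      T - augRight K B T ⊗ₜ 1 - 1 ⊗ₜ augLeft K B T +
        augmentation K B (augRight K B T) • (1 ⊗ₜ 1) := by
  induction T using TensorProduct.induction_on with
  | zero => simp
  | add S T hS hT =>
    simp only [map_add, hS, hT, TensorProduct.add_tmul, TensorProduct.tmul_add, add_smul]
    abel
  | tmul f g =>
    have h1 : f ⊗ₜ[K] (augmentation K B g • (1 : GroupAlg K B)) = (augmentation K B g • f) ⊗ₜ 1 :=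
      (TensorProduct.smul_tmul _ _ _).symm
    have h2 : (augmentation K B f • (1 : GroupAlg K B)) ⊗ₜ[K] g = 1 ⊗ₜ (augmentation K B f • g) :=
      TensorProduct.smul_tmul _ _ _
    rw [TensorProduct.map_tmul, TensorProduct.map_tmul, Submodule.subtype_apply,
      Submodule.subtype_apply, augProj_coe, augProj_coe, augRight_tmul, augLeft_tmul, map_smul,
      TensorProduct.sub_tmul, TensorProduct.tmul_sub, TensorProduct.tmul_sub,
      TensorProduct.smul_tmul_smul, h1, h2, smul_eq_mul, mul_comm]
    abel

theorem anti_one : GroupAlg.anti K B 1 = 1 := by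
  rw [← GroupAlg.unop_antipode, map_one]
  rfl

theorem augmentation_anti (z : GroupAlg K B) :
    augmentation K B (GroupAlg.anti K B z) = augmentation K B z := by
  rw [augmentation_apply, augmentation_apply, GroupAlg.anti_ofConv_apply, HopfAlgebra.antipode_one]

/-- The sums of products `y z` with `y ^ p = 0` and `z` in the augmentation ideal. -/
def nilProducts (K : Type*) [Field K] (B : Type*) [CommRing B] [HopfAlgebra K B] (p : ℕ) :
    AddSubmonoid (GroupAlg K B) :=
  AddSubmonoid.closure {w | ∃ y z, y ^ p = 0 ∧ augmentation K B z = 0 ∧ w = y * z}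

variable {p : ℕ}

theorem mulAnti_mem_nilProducts [Coalgebra.IsCocomm K B] {T : GroupAlg K B ⊗[K] GroupAlg K B}
    (hT : T ∈ nilTensors (LinearMap.ker (augmentation K B)) p) :
    mulAnti K B T ∈ nilProducts K B p := by
  refine AddSubmonoid.closure_induction (motive := fun T _ => mulAnti K B T ∈ nilProducts K B p)
    ?_ ?_ (fun a b _ _ ha hb => ?_) hT
  · rintro _ ⟨n, a, hn, ha, rfl | rfl⟩
    · rw [mulAnti_tmul]
      exact AddSubmonoid.subset_closure
        ⟨n, _, hn, (augmentation_anti a).trans ha, rfl⟩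
    · rw [mulAnti_tmul, mul_comm]
      exact AddSubmonoid.subset_closure
        ⟨_, a, by rw [← GroupAlg.anti_pow, hn, map_zero], ha, rfl⟩
  · rw [map_zero]
    exact zero_mem _
  · rw [map_add]
    exact add_mem ha hb

variable [Module.Finite K B]

theorem augRight_apply (T : GroupAlg K B ⊗[K] GroupAlg K B) (b : B) :
    (augRight K B T).ofConv b = (prodGroupAlg K B T).ofConv (b ⊗ₜ 1) := by
  induction T using TensorProduct.induction_on with
  | zero => simp
  | add S T hS hT => simp only [map_add, WithConv.ofConv_add, LinearMap.add_apply, hS, hT]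
  | tmul f g =>
    rw [prodGroupAlg_tmul_apply, augRight_tmul, augmentation_apply, mul_comm]
    rfl

theorem augLeft_apply (T : GroupAlg K B ⊗[K] GroupAlg K B) (b : B) :
    (augLeft K B T).ofConv b = (prodGroupAlg K B T).ofConv (1 ⊗ₜ b) := by
  induction T using TensorProduct.induction_on with
  | zero => simp
  | add S T hS hT => simp only [map_add, WithConv.ofConv_add, LinearMap.add_apply, hS, hT]
  | tmul f g =>
    rw [prodGroupAlg_tmul_apply, augLeft_tmul, augmentation_apply]
    rfl

theorem mulAnti_apply (T : GroupAlg K B ⊗[K] GroupAlg K B) (b : B) :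
    (mulAnti K B T).ofConv b = (prodGroupAlg K B T).ofConv
      ((HopfAlgebra.antipode K).lTensor B (Coalgebra.comul b)) := by
  induction T using TensorProduct.induction_on with
  | zero => simp
  | add S T hS hT => simp only [map_add, WithConv.ofConv_add, LinearMap.add_apply, hS, hT]
  | tmul f g =>
    rw [mulAnti_tmul, LinearMap.convMul_def]
    simp only [LinearMap.comp_apply]
    induction (Coalgebra.comul (R := K) b) using TensorProduct.induction_on with
    | zero => simp
    | add x y hx hy => simp only [map_add, hx, hy]
    | tmul a a' =>
      rw [LinearMap.lTensor_tmul, prodGroupAlg_tmul_apply, TensorProduct.map_tmul,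
        LinearMap.mul'_apply, GroupAlg.anti_ofConv_apply]

variable [Coalgebra.IsCocomm K B]

/-- Over a perfect field the antipode of a `p`-nilpotent element `x` of the group algebra of an
abelian group scheme satisfies `-S(x) = x + ∑ yᵢ zᵢ` with `yᵢ ^ p = 0` and `zᵢ` in the augmentation
ideal. The correction term comes from `Δ(x) - x ⊗ 1 - 1 ⊗ x`, an element of `I ⊗ I` with
vanishing `p`-th power. -/
theorem neg_anti_sub_mem_nilProducts [Fact p.Prime] [CharP K p] [PerfectRing K p]
    {x : GroupAlg K B} (hx : x ^ p = 0) :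
    -GroupAlg.anti K B x - x ∈ nilProducts K B p := by
  have : Nontrivial (GroupAlg K B) := (augmentationAlgHom K B).toRingHom.domain_nontrivial
  let Θ := prodGroupAlgEquiv K B
  let T := Θ.symm (GroupAlg.map (Bialgebra.mulBialgHom K B) x)
  have hT : T ^ p = 0 := by
    rw [← map_pow, ← map_pow, hx, map_zero, map_zero]
  have hval : ∀ m, (prodGroupAlg K B T).ofConv m = x.ofConv (LinearMap.mul' K B m) := by
    intro m
    have h : prodGroupAlg K B T = GroupAlg.map (Bialgebra.mulBialgHom K B) x :=
      Θ.apply_symm_apply _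
    rw [h]
    rfl
  have hε : augmentation K B x = 0 := augmentation_eq_zero_of_isNilpotent ⟨p, hx⟩
  have hR : augRight K B T = x := by
    apply WithConv.ofConv_injective
    ext b
    rw [augRight_apply, hval, LinearMap.mul'_apply, mul_one]
  have hL : augLeft K B T = x := by
    apply WithConv.ofConv_injective
    ext b
    rw [augLeft_apply, hval, LinearMap.mul'_apply, one_mul]
  have hS : mulAnti K B T = 0 := by
    apply WithConv.ofConv_injective
    ext b
    rw [mulAnti_apply, hval, HopfAlgebra.mul_antipode_lTensor_comul_apply,
      Algebra.algebraMap_eq_smul_one, map_smul, ← augmentation_apply, hε, smul_zero]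
    rfl
  have hD := map_augProj T
  rw [hR, hL, hε, zero_smul, add_zero] at hD
  have h := mulAnti_mem_nilProducts (mem_nilTensors_of_eq_sub_tmul_sub_tmul
    (fun y hy => augmentation_eq_zero_of_isNilpotent ⟨p, hy⟩) hD hT hx)
  rw [map_sub, map_sub, hS, mulAnti_tmul, mulAnti_tmul, anti_one, mul_one, one_mul] at h
  rwa [zero_sub, sub_eq_add_neg, add_comm, ← sub_eq_add_neg] at h

end Antipode

/-! ### `π`-points as elements of the group algebra -/

section PiElements

theorem add_smul_pow_char_eq_zero {L H : Type*} [Field L] [Ring H] [Algebra L H] {p : ℕ}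
    [Fact p.Prime] [CharP L p] {a b : H} (hab : Commute a b) (ha : a ^ p = 0) (hb : b ^ p = 0)
    (c : L) : (a + c • b) ^ p = 0 := by
  nontriviality H
  have : CharP H p := charP_of_injective_algebraMap (algebraMap L H).injective p
  rw [add_pow_char_of_commute p (hab.smul_right c), _root_.smul_pow, ha, hb, smul_zero, add_zero]

variable {k : Type*} [Field k] {A : Type*} [CommRing A] [HopfAlgebra k A] [Module.Finite k A]
  {V : Type*} [AddCommGroup V] [Module k V] [FiniteDimensional k V]

section Ranks

variable {K : Type*} [Field K] [Algebra k K]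

/-- A nilpotent operator of order `p` has the largest ranks when all its Jordan blocks have
size `p`. -/
theorem mul_rk_le (ρ : GroupAlg k A →ₐ[k] Module.End k V) {p : ℕ}
    {x : GroupAlg K (K ⊗[k] A)} (hx : x ^ p = 0) (j : ℕ) :
    p * rk ρ x j ≤ (p - j) * finrank k V := by
  rw [rk, ← finrank_baseChange (R := K) (M' := V)]
  exact mul_finrank_range_pow_le (by rw [← map_pow, hx, map_zero]) j

/-- The ranks of `x + X y` over the rational function field are the generic ranks of the pencil. -/
theorem rk_extend_add_smul (ρ : GroupAlg k A →ₐ[k] Module.End k V)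
    (x y : GroupAlg K (K ⊗[k] A)) (j : ℕ) :
    rk ρ (GroupAlg.extend K (RatFunc K) x +
        algebraMap K[X] (RatFunc K) X • GroupAlg.extend K (RatFunc K) y) j =
      finrank K[X] (LinearMap.range (pencil (baseChange K ρ x) (baseChange K ρ y) ^ j)) := by
  rw [← finrank_range_pencil (RatFunc K), rk]
  symm
  refine finrank_range_pow_conj
    (TensorProduct.AlgebraTensorModule.cancelBaseChange k K (RatFunc K) (RatFunc K) V) _ _ ?_ j
  intro m
  rw [LinearMap.add_apply, LinearMap.smul_apply, map_add, map_smul, baseChange_extend_apply,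
    baseChange_extend_apply, map_add, map_smul]
  rfl

end Ranks

/-- The images `α(t)` of the `π`-points `α` over `K`: the `p`-nilpotent elements `x` of the group
algebra of a unipotent abelian closed subgroup scheme of `G_K` for which `KG` is a free
`K[t]/t^p`-module; the latter is expressed by the rank of `x ^ (p - 1)`. -/
def IsPiElement (p : ℕ) {K : Type*} [Field K] [Algebra k K] (x : GroupAlg K (K ⊗[k] A)) : Prop :=
  p * rk (Algebra.lmul k (GroupAlg k A)) x (p - 1) = finrank k (GroupAlg k A) ∧
    ∃ (I : Ideal (K ⊗[k] A)) (_ : I.IsHopfIdeal K),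
      Coalgebra.IsCocomm K ((K ⊗[k] A) ⧸ I) ∧ IsUnipotent K ((K ⊗[k] A) ⧸ I) ∧
        ∃ y : GroupAlg K ((K ⊗[k] A) ⧸ I), y ^ p = 0 ∧
          GroupAlg.map (Bialgebra.Quotient.mkBialgHom (R := K) I) y = x

variable {p : ℕ}

theorem IsPiElement.pow_eq_zero {K : Type*} [Field K] [Algebra k K] {x : GroupAlg K (K ⊗[k] A)}
    (h : IsPiElement p x) : x ^ p = 0 := by
  obtain ⟨-, I, _, -, -, y, hy, rfl⟩ := h
  rw [← map_pow, hy, map_zero]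

theorem isLeftFlat_iff_rk [Fact p.Prime] {K : Type*} [Field K] [Algebra k K]
    (α : TruncPoly K p →ₐ[K] GroupAlg K (K ⊗[k] A)) :
    IsLeftFlat α.toRingHom ↔
      p * rk (Algebra.lmul k (GroupAlg k A)) (α (TruncPoly.t K p)) (p - 1) =
        finrank k (GroupAlg k A) := by
  rw [isLeftFlat_iff (Fact.out : p.Prime).pos, rk_regular,
    ← (GroupAlg.baseChangeEquiv k A K).toLinearEquiv.finrank_eq, finrank_baseChange]

theorem IsPiPoint.isPiElement [Fact p.Prime] {K : Type*} [Field K] [Algebra k K]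
    {α : TruncPoly K p →ₐ[K] GroupAlg K (K ⊗[k] A)} (h : IsPiPoint α) :
    IsPiElement p (α (TruncPoly.t K p)) := by
  obtain ⟨hflat, I, hI, hc, hu, β, rfl⟩ := h
  refine ⟨(isLeftFlat_iff_rk _).1 hflat, I, hI, hc, hu, β (TruncPoly.t K p), ?_, rfl⟩
  rw [← map_pow, TruncPoly.t_pow_eq_zero, map_zero]

theorem IsPiElement.exists_isPiPoint [Fact p.Prime] {K : Type*} [Field K] [Algebra k K]
    {x : GroupAlg K (K ⊗[k] A)} (h : IsPiElement p x) :
    ∃ α : TruncPoly K p →ₐ[K] GroupAlg K (K ⊗[k] A), IsPiPoint α ∧ α (TruncPoly.t K p) = x := by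
  have ht : TruncPoly.lift x h.pow_eq_zero (TruncPoly.t K p) = x := TruncPoly.lift_t _ _
  obtain ⟨hr, I, hI, hc, hu, y, hy, hyx⟩ := h
  refine ⟨TruncPoly.lift x _, ⟨(isLeftFlat_iff_rk _).2 (by rwa [ht]), I, hI, hc, hu,
    TruncPoly.lift y hy, TruncPoly.algHom_ext ?_⟩, ht⟩
  rw [ht, AlgHom.comp_apply, TruncPoly.lift_t, hyx]

/-- The dual of a `K[t]/t^p`-module, formed with `t ↦ -t`, has the same ranks. -/
theorem finrank_range_dualVia_antipode_pow {K : Type*} [Field K] {W : Type*} [AddCommGroup W]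
    [Module K W] [FiniteDimensional K W] (σ : TruncPoly K p →ₐ[K] Module.End K W) (j : ℕ) :
    finrank K (LinearMap.range
        (dualVia (TruncPoly.antipode K p) σ (TruncPoly.t K p) ^ j)) =
      finrank K (LinearMap.range (σ (TruncPoly.t K p) ^ j)) := by
  have h : (TruncPoly.antipode K p (TruncPoly.t K p)).unop = -TruncPoly.t K p := by
    change Polynomial.aeval (Ideal.Quotient.mk (Ideal.span {(X : K[X]) ^ p}) (-X)) X = _
    rw [aeval_X, map_neg]
    rfl
  rw [← map_pow, ← finrank_range_neg_pow, ← map_neg, ← h, ← map_pow, ← MulOpposite.unop_pow,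
    ← map_pow]
  exact LinearMap.finrank_range_dualMap_eq_finrank_range _

universe w

/-- The rank function `r` of some `x ∈ KG` on `M` is maximal if no `π`-element over a field
extension of `k` has strictly greater ranks on `M`. -/
def IsMaximalRank (p : ℕ) (ρ : GroupAlg k A →ₐ[k] Module.End k V) (r : ℕ → ℕ) : Prop :=
  ∀ (L : Type w) [Field L] [Algebra k L] (y : GroupAlg L (L ⊗[k] A)), IsPiElement p y →
    (∀ j, r j ≤ rk ρ y j) → rk ρ y = r

/-- The dominance order on Jordan types is the pointwise order on the ranks of the powers of `t`, so
maximality can be expressed by ranks. -/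
theorem hasMaximalJordanType_iff [Fact p.Prime] {K : Type w} [Field K] [Algebra k K]
    (α : TruncPoly K p →ₐ[K] GroupAlg K (K ⊗[k] A)) (ρ : GroupAlg k A →ₐ[k] Module.End k V) :
    HasMaximalJordanType α ρ ↔ IsMaximalRank.{w} p ρ (rk ρ (α (TruncPoly.t K p))) := by
  have key : ∀ {L : Type w} [Field L] [Algebra k L]
      (β : TruncPoly L p →ₐ[L] GroupAlg L (L ⊗[k] A)) {b : JordanType p},
      HasJordanType (restrict β ρ) b → ∀ j, b.tail j = rk ρ (β (TruncPoly.t L p)) j :=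
    fun β b hb j => (hb.finrank_range_pow j).symm
  have hzero : ∀ {L : Type w} [Field L] [Algebra k L] (y : GroupAlg L (L ⊗[k] A)),
      rk ρ y 0 = finrank k V := fun {L} _ _ y => by
    rw [rk, pow_zero, Module.End.one_eq_id, LinearMap.range_id, finrank_top, finrank_baseChange]
  constructor
  · intro h L _ _ y hy hle
    by_contra hne
    obtain ⟨β, hβ, rfl⟩ := hy.exists_isPiPoint
    obtain ⟨a, ha⟩ := exists_hasJordanType (restrict α ρ)
    obtain ⟨b, hb⟩ := exists_hasJordanType (restrict β ρ)
    refine h ⟨L, _, _, β, hβ, a, b, ha, hb, ⟨?_, fun j => ?_⟩, ?_⟩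
    · rw [key _ ha, key _ hb, hzero, hzero]
    · rw [key _ ha, key _ hb]
      exact hle j
    · by_contra! hcon
      refine hne (funext fun j => le_antisymm ?_ (hle j))
      rw [← key _ ha, ← key _ hb]
      exact hcon j
  · rintro h ⟨L, _, _, β, hβ, a, b, ha, hb, ⟨-, hle⟩, j, hj⟩
    have h1 := h L (β (TruncPoly.t L p)) hβ.isPiElement fun j => by
      rw [← key _ ha, ← key _ hb]
      exact hle j
    rw [key _ ha, key _ hb, h1] at hj
    exact lt_irrefl _ hj

theorem IsPiElement.extend {K : Type*} [Field K] [Algebra k K] (L : Type*) [Field L] [Algebra k L]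
    [Algebra K L] [IsScalarTower k K L] {x : GroupAlg K (K ⊗[k] A)} (h : IsPiElement p x) :
    IsPiElement p (GroupAlg.extend K L x) := by
  have hx := h.pow_eq_zero
  obtain ⟨hr, I, hI, hc, hu, y, hy, rfl⟩ := h
  obtain ⟨J, hJ, hJc, hJu, hJ0⟩ := exists_subgroup_baseChange L
    (Bialgebra.Quotient.mkBialgHom (R := K) I) (fun _ => rfl) hu
  obtain ⟨y', hy'⟩ := mem_range_map_mk.2 (hJ0 y)
  refine ⟨by rwa [rk_extend], J, hJ, hJc, hJu, y', map_mk_injective J ?_, hy'⟩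
  rw [map_pow, hy', ← map_pow, hx, map_zero, map_zero]

end PiElements

/-! ### Deforming `π`-points inside an abelian subgroup scheme -/

section Deformation

variable {k : Type*} [Field k] {A : Type*} [CommRing A] [HopfAlgebra k A] [Module.Finite k A]
  {V : Type*} [AddCommGroup V] [Module k V] [FiniteDimensional k V] {p : ℕ}
  {F : Type*} [Field F] [Algebra k F] {I : Ideal (F ⊗[k] A)} [I.IsHopfIdeal F]
  [Coalgebra.IsCocomm F ((F ⊗[k] A) ⧸ I)]

/-- The generic member `x + X y`, over the rational function field, of a pencil of `p`-nilpotent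
elements of the group algebra of a unipotent abelian subgroup scheme is a `π`-element if `x` is. -/
theorem isPiElement_extend_add_smul [Fact p.Prime] [CharP F p]
    (hI : IsUnipotent F ((F ⊗[k] A) ⧸ I)) {x y : GroupAlg F ((F ⊗[k] A) ⧸ I)}
    (hx : x ^ p = 0) (hy : y ^ p = 0)
    (h : IsPiElement p (GroupAlg.map (Bialgebra.Quotient.mkBialgHom (R := F) I) x)) :
    IsPiElement p (GroupAlg.extend F (RatFunc F)
        (GroupAlg.map (Bialgebra.Quotient.mkBialgHom (R := F) I) x) +
      algebraMap F[X] (RatFunc F) X • GroupAlg.extend F (RatFunc F)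
        (GroupAlg.map (Bialgebra.Quotient.mkBialgHom (R := F) I) y)) := by
  set ι := GroupAlg.map (Bialgebra.Quotient.mkBialgHom (R := F) I)
  set c := algebraMap F[X] (RatFunc F) X
  have : CharP (RatFunc F) p :=
    charP_of_injective_algebraMap (algebraMap F (RatFunc F)).injective p
  obtain ⟨J, hJ, hJc, hJu, hJ0⟩ := exists_subgroup_baseChange (RatFunc F)
    (Bialgebra.Quotient.mkBialgHom (R := F) I) (fun _ => rfl) hI
  have hcomm : Commute (GroupAlg.extend F (RatFunc F) (ι x))
      (GroupAlg.extend F (RatFunc F) (ι y)) :=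
    ((Commute.all x y).map ι).map (GroupAlg.extend F (RatFunc F))
  have hw : (GroupAlg.extend F (RatFunc F) (ι x) +
      c • GroupAlg.extend F (RatFunc F) (ι y)) ^ p = 0 :=
    add_smul_pow_char_eq_zero hcomm (by rw [← map_pow, ← map_pow, hx, map_zero, map_zero])
      (by rw [← map_pow, ← map_pow, hy, map_zero, map_zero]) c
  obtain ⟨u, hu⟩ := mem_range_map_mk.2 fun a ha => show
      (GroupAlg.extend F (RatFunc F) (ι x) + c • GroupAlg.extend F (RatFunc F) (ι y)).ofConv a = 0
      from by
    rw [WithConv.ofConv_add, WithConv.ofConv_smul, LinearMap.add_apply, LinearMap.smul_apply,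
      hJ0 x a ha, hJ0 y a ha, smul_zero, add_zero]
  refine ⟨le_antisymm ?_ ?_, J, hJ, hJc, hJu, u, map_mk_injective J ?_, hu⟩
  · refine (mul_rk_le _ hw _).trans_eq ?_
    rw [Nat.sub_sub_self (Fact.out : p.Prime).one_le, one_mul]
  · rw [rk_extend_add_smul, ← h.1]
    exact Nat.mul_le_mul_left p (finrank_range_pow_le_pencil _ _ _)
  · rw [map_pow, hu, hw, map_zero]

/-- If the ranks of `x` equal the generic ranks of the pencil `x + X y`, then substituting a
nilpotent element `z` for `X` does not decrease them. -/
theorem rk_map_le_rk_map_add_mul (ρ : GroupAlg k A →ₐ[k] Module.End k V)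
    {x y z : GroupAlg F ((F ⊗[k] A) ⧸ I)} (hz : IsNilpotent z) (j : ℕ)
    (h : rk ρ (GroupAlg.extend F (RatFunc F)
        (GroupAlg.map (Bialgebra.Quotient.mkBialgHom (R := F) I) x) +
      algebraMap F[X] (RatFunc F) X • GroupAlg.extend F (RatFunc F)
        (GroupAlg.map (Bialgebra.Quotient.mkBialgHom (R := F) I) y)) j ≤
      rk ρ (GroupAlg.map (Bialgebra.Quotient.mkBialgHom (R := F) I) x) j) :
    rk ρ (GroupAlg.map (Bialgebra.Quotient.mkBialgHom (R := F) I) x) j ≤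
      rk ρ (GroupAlg.map (Bialgebra.Quotient.mkBialgHom (R := F) I) (x + y * z)) j := by
  set ι := GroupAlg.map (Bialgebra.Quotient.mkBialgHom (R := F) I)
  have hcomm : ∀ a b, Commute (baseChange F ρ (ι a)) (baseChange F ρ (ι b)) := fun a b =>
    ((Commute.all a b).map ι).map (baseChange F ρ)
  rw [rk_extend_add_smul] at h
  rw [rk, rk, map_add, map_mul, map_add, map_mul]
  exact finrank_range_pow_le_of_pencil_le (hcomm _ _) (hcomm _ _)
    ((hz.map ι).map (baseChange F ρ)) j h

/-- Perturbing a `π`-element `x` of `KC` by `y z` with `y ^ p = 0` and `z` in the augmentation ideal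
gives a `π`-element. The generic rank of `(x + X y) ^ (p - 1)` on the regular representation cannot
exceed that of `x ^ (p - 1)`, which is the largest possible. -/
theorem IsPiElement.map_add_mul [Fact p.Prime] [CharP F p]
    (hI : IsUnipotent F ((F ⊗[k] A) ⧸ I)) {x y z : GroupAlg F ((F ⊗[k] A) ⧸ I)}
    (hx : x ^ p = 0) (hy : y ^ p = 0) (hz : augmentation F _ z = 0)
    (h : IsPiElement p (GroupAlg.map (Bialgebra.Quotient.mkBialgHom (R := F) I) x)) :
    (x + y * z) ^ p = 0 ∧
      IsPiElement p (GroupAlg.map (Bialgebra.Quotient.mkBialgHom (R := F) I) (x + y * z)) := by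
  have hxyz : (x + y * z) ^ p = 0 := by
    have := add_smul_pow_char_eq_zero (L := F) (Commute.all x (y * z)) hx
      (by rw [mul_pow, hy, zero_mul]) 1
    rwa [one_smul] at this
  refine ⟨hxyz, le_antisymm ?_ ?_, I, inferInstance, inferInstance, hI, _, hxyz, rfl⟩
  · refine (mul_rk_le (p := p) _ (by rw [← map_pow, hxyz, map_zero]) _).trans_eq ?_
    rw [Nat.sub_sub_self (Fact.out : p.Prime).one_le, one_mul]
  · rw [← h.1]
    refine Nat.mul_le_mul_left p (rk_map_le_rk_map_add_mul _ (hI.isNilpotent hz) _ ?_)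
    refine Nat.le_of_mul_le_mul_left ?_ (Fact.out : p.Prime).pos
    rw [h.1, (isPiElement_extend_add_smul hI hx hy h).1]

end Deformation

/-! ### Maximal `π`-points and the antipode -/

section Antipode

universe w

variable {k : Type*} [Field k] {A : Type*} [CommRing A] [HopfAlgebra k A] [Module.Finite k A]
  {V : Type*} [AddCommGroup V] [Module k V] [FiniteDimensional k V] {p : ℕ} [Fact p.Prime]

/-- Perturbing by `y z` preserves the ranks on a module where they are maximal: `x + X y` over the
rational function field is a `π`-element of no smaller ranks, hence of the same ranks. -/
theorem IsMaximalRank.rk_map_add_mul {F : Type w} [Field F] [Algebra k F] {I : Ideal (F ⊗[k] A)}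
    [I.IsHopfIdeal F] [Coalgebra.IsCocomm F ((F ⊗[k] A) ⧸ I)] [CharP F p]
    (hI : IsUnipotent F ((F ⊗[k] A) ⧸ I)) {x y z : GroupAlg F ((F ⊗[k] A) ⧸ I)}
    (hx : x ^ p = 0) (hy : y ^ p = 0) (hz : augmentation F _ z = 0)
    (h : IsPiElement p (GroupAlg.map (Bialgebra.Quotient.mkBialgHom (R := F) I) x))
    {ρ : GroupAlg k A →ₐ[k] Module.End k V}
    (hmax : IsMaximalRank.{w} p ρ
      (rk ρ (GroupAlg.map (Bialgebra.Quotient.mkBialgHom (R := F) I) x))) :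
    rk ρ (GroupAlg.map (Bialgebra.Quotient.mkBialgHom (R := F) I) (x + y * z)) =
      rk ρ (GroupAlg.map (Bialgebra.Quotient.mkBialgHom (R := F) I) x) := by
  refine hmax F _ (h.map_add_mul hI hx hy hz).2 fun j => ?_
  refine rk_map_le_rk_map_add_mul (y := y) ρ (hI.isNilpotent hz) j (le_of_eq ?_)
  refine congrFun (hmax (RatFunc F) _ (isPiElement_extend_add_smul hI hx hy h) fun j => ?_) j
  rw [rk_extend_add_smul]
  exact finrank_range_pow_le_pencil _ _ _

theorem IsPiElement.map_add_of_mem_nilProducts {F : Type w} [Field F] [Algebra k F]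
    {I : Ideal (F ⊗[k] A)}
    [I.IsHopfIdeal F] [Coalgebra.IsCocomm F ((F ⊗[k] A) ⧸ I)] [CharP F p]
    (hI : IsUnipotent F ((F ⊗[k] A) ⧸ I)) (ρ : GroupAlg k A →ₐ[k] Module.End k V)
    {v : GroupAlg F ((F ⊗[k] A) ⧸ I)} (hv : v ∈ nilProducts F ((F ⊗[k] A) ⧸ I) p) :
    ∀ x : GroupAlg F ((F ⊗[k] A) ⧸ I), x ^ p = 0 →
      IsPiElement p (GroupAlg.map (Bialgebra.Quotient.mkBialgHom (R := F) I) x) →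
      (x + v) ^ p = 0 ∧
        IsPiElement p (GroupAlg.map (Bialgebra.Quotient.mkBialgHom (R := F) I) (x + v)) ∧
        (IsMaximalRank.{w} p ρ
            (rk ρ (GroupAlg.map (Bialgebra.Quotient.mkBialgHom (R := F) I) x)) →
          rk ρ (GroupAlg.map (Bialgebra.Quotient.mkBialgHom (R := F) I) (x + v)) =
            rk ρ (GroupAlg.map (Bialgebra.Quotient.mkBialgHom (R := F) I) x)) := by
  refine AddSubmonoid.closure_induction ?_ ?_ (fun a b _ _ ha hb => ?_) hv
  · rintro _ ⟨y, z, hy, hz, rfl⟩ x hx h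
    obtain ⟨h1, h2⟩ := h.map_add_mul hI hx hy hz
    exact ⟨h1, h2, IsMaximalRank.rk_map_add_mul hI hx hy hz h⟩
  · intro x hx h
    rw [add_zero]
    exact ⟨hx, h, fun _ => rfl⟩
  · intro x hx h
    obtain ⟨h1, h2, h3⟩ := ha x hx h
    obtain ⟨h4, h5, h6⟩ := hb _ h1 h2
    rw [← add_assoc]
    refine ⟨h4, h5, fun hmax => ?_⟩
    rw [h6 (by rwa [h3 hmax]), h3 hmax]

variable [CharP k p]

/-- Over a perfect field, `-S(x)` is a `π`-element if `x` is, with the same ranks on a module on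
which `x` has maximal ranks. -/
theorem IsPiElement.neg_anti_of_perfect {F : Type w} [Field F] [Algebra k F] [PerfectField F]
    {x : GroupAlg F (F ⊗[k] A)} (h : IsPiElement p x) (ρ : GroupAlg k A →ₐ[k] Module.End k V) :
    IsPiElement p (-GroupAlg.anti F (F ⊗[k] A) x) ∧
      (IsMaximalRank.{w} p ρ (rk ρ x) → rk ρ (-GroupAlg.anti F (F ⊗[k] A) x) = rk ρ x) := by
  have : CharP F p := charP_of_injective_algebraMap (algebraMap k F).injective p
  have h' := h
  obtain ⟨-, I, hI, hc, hu, y, hy, rfl⟩ := h'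
  obtain ⟨-, h2⟩ := h.map_add_of_mem_nilProducts hu ρ (neg_anti_sub_mem_nilProducts hy) y hy
  rwa [add_sub_cancel, map_neg, map_mk_anti] at h2

/-- Passing to an algebraic closure changes neither ranks nor maximality. -/
theorem rk_anti_eq {K : Type w} [Field K] [Algebra k K] {x : GroupAlg K (K ⊗[k] A)}
    (h : IsPiElement p x) {ρ : GroupAlg k A →ₐ[k] Module.End k V}
    (hmax : IsMaximalRank.{w} p ρ (rk ρ x)) :
    rk ρ (GroupAlg.anti K (K ⊗[k] A) x) = rk ρ x := by
  let F := AlgebraicClosure K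
  have hext : ∀ y : GroupAlg K (K ⊗[k] A), rk ρ (GroupAlg.extend K F y) = rk ρ y :=
    fun y => funext (rk_extend F ρ y)
  rw [← hext x] at hmax
  have h1 := ((h.extend F).neg_anti_of_perfect ρ).2 hmax
  rw [← hext, ← hext x, ← h1, GroupAlg.extend_anti]
  exact _root_.funext fun j => (rk_neg ρ _ j).symm

theorem IsMaximalRank.dual {K : Type w} [Field K] [Algebra k K] {x : GroupAlg K (K ⊗[k] A)}
    (h : IsPiElement p x) {ρ : GroupAlg k A →ₐ[k] Module.End k V}
    (hmax : IsMaximalRank.{w} p ρ (rk ρ x)) :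
    IsMaximalRank.{w} p (dual ρ) (rk (FiniteGroupScheme.dual ρ) x) := by
  have hx : rk (FiniteGroupScheme.dual ρ) x = rk ρ x :=
    (funext (rk_dual ρ x)).trans (rk_anti_eq h hmax)
  intro L _ _ y hy hle
  let F := AlgebraicClosure L
  -- over the algebraic closure, `-S(y)` is a `π`-element with the ranks on `M` of `y` on `M^#`
  have hy2 : rk ρ (-GroupAlg.anti F (F ⊗[k] A) (GroupAlg.extend L F y)) =
      rk (FiniteGroupScheme.dual ρ) y := by
    funext j
    rw [rk_neg, ← GroupAlg.extend_anti, rk_extend, rk_dual]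
  rw [hx] at hle ⊢
  rw [← hy2] at hle ⊢
  exact hmax F _ ((hy.extend F).neg_anti_of_perfect ρ).1 hle

theorem isMaximalRank_dual_iff {K : Type w} [Field K] [Algebra k K] {x : GroupAlg K (K ⊗[k] A)}
    (h : IsPiElement p x) (ρ : GroupAlg k A →ₐ[k] Module.End k V) :
    IsMaximalRank.{w} p (dual ρ) (rk (dual ρ) x) ↔ IsMaximalRank.{w} p ρ (rk ρ x) := by
  refine ⟨fun hmax => ?_, fun hmax => hmax.dual h⟩
  have hdd : ∀ {L : Type w} [Field L] [Algebra k L] (y : GroupAlg L (L ⊗[k] A)),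
      rk (dual (dual ρ)) y = rk ρ y := fun y => by
    funext j
    rw [rk_dual, rk_dual, GroupAlg.anti_anti]
  have h2 := hmax.dual h
  intro L _ _ y hy hle
  rw [← hdd, ← hdd]
  refine h2 L y hy fun j => ?_
  rw [hdd, hdd]
  exact hle j

end Antipode

end FiniteGroupScheme

end

open scoped TensorProduct in
theorem proposition5p2 {k : Type*} [Field k] (p : ℕ) [Fact p.Prime] [CharP k p]
    {A : Type*} [CommRing A] [HopfAlgebra k A] [Module.Finite k A]
    {V : Type*} [AddCommGroup V] [Module k V] [FiniteDimensional k V]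
    (ρ : FiniteGroupScheme.GroupAlg k A →ₐ[k] Module.End k V)
    {K : Type*} [Field K] [Algebra k K]
    (α : FiniteGroupScheme.TruncPoly K p →ₐ[K] FiniteGroupScheme.GroupAlg K (K ⊗[k] A))
    (hα : FiniteGroupScheme.IsPiPoint α) :
    (FiniteGroupScheme.HasMaximalJordanType α ρ →
      FiniteGroupScheme.RepIso
          ((FiniteGroupScheme.dual (FiniteGroupScheme.baseChange K ρ)).comp α)
          ((FiniteGroupScheme.baseChange K ρ).comp α) ∧
        FiniteGroupScheme.RepIso
          ((FiniteGroupScheme.baseChange K ρ).comp α)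
          (FiniteGroupScheme.dualVia (FiniteGroupScheme.TruncPoly.antipode K p)
            ((FiniteGroupScheme.baseChange K ρ).comp α))) ∧
      (FiniteGroupScheme.HasMaximalJordanType α ρ ↔
        FiniteGroupScheme.HasMaximalJordanType α (FiniteGroupScheme.dual ρ)) := by
  open FiniteGroupScheme in
  have hpi := hα.isPiElement
  refine ⟨fun h => ⟨repIso_of_finrank_range_pow_eq fun j => ?_,
    repIso_of_finrank_range_pow_eq fun j => ?_⟩, ?_⟩
  · rw [hasMaximalJordanType_iff] at h
    exact (finrank_range_dual_pow _ j).trans (congrFun (rk_anti_eq hpi h) j)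
  · exact (finrank_range_dualVia_antipode_pow _ j).symm
  · rw [hasMaximalJordanType_iff, hasMaximalJordanType_iff, isMaximalRank_dual_iff hpi]
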